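/- **The ring.** Let $\Gamma'=\mathbb Z[P_1,P_2,\dots]\big/\big(P_k^2+2\sum_{j=1}^{k-1}(-1)^jP_{k+j}P_{k-j}+(-1)^kP_{2k},\ k\ge 1\big)$, and put $Q_0=1$, $Q_k=2P_k$ for $k\ge1$, and $Q=1+Q_1+Q_2+\cdots$. For a series $c=1+c_1+c_2+\cdots$ write $c_m$ for its term of degree $m$ (each variable $t_i,x_i,y_i$ has degree $1$). **Pfaffians.** For a skew-symmetric $r\times r$ matrix $M=(m_{kl})$ and elements $m_1,\dots,m_r$, let $\mathrm{Pf}$ be the usual Pfaffian of $M$ if $r$ is even, and $\sum_{k=1}^r(-1)^{k-1}m_k\,\mathrm{Pf}(M_k)$ if $r$ is odd, where $M_k$ is $M$ without its $k$-th row and column. Let $c(1),\dots,c(r)$ be products of factors $1+z$ with $z$ a variable, put $d(k)=Q\cdot c(k)$, and let $\lambda_1>\dots>\lambda_r\ge 0$. * Type B (where $\lambda_r>0$ and $\deg c(k)<\lambda_k$): $\mathrm{Pf}^B_\lambda(c)$ is the Pfaffian with $m_k=\tfrac12 d(k)_{\lambda_k}$ and $m_{kl}=\tfrac14\big(d(k)_{\lambda_k}d(l)_{\lambda_l}+2\sum_{j=1}^{\lambda_l}(-1)^jd(k)_{\lambda_k+j}d(l)_{\lambda_l-j}\big)$.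 * Type D (where $\deg c(k)\le\lambda_k$): $\mathrm{Pf}^D_\lambda(c)$ is the Pfaffian with $m_k=\tfrac12\big(d(k)_{\lambda_k}+c(k)_{\lambda_k}\big)$ and $m_{kl}=\tfrac14\big((d(k)_{\lambda_k}-c(k)_{\lambda_k})(d(l)_{\lambda_l}+c(l)_{\lambda_l})+2\sum_{j=1}^{\lambda_l}(-1)^jd(k)_{\lambda_k+j}d(l)_{\lambda_l-j}\big)$. (The divisions are possible in $\Gamma'[t]$, respectively $\Gamma'[x,y]$.) **Partitions and basic polynomials.** A strict partition is a sequence $\mu_1>\dots>\mu_r>0$; a partition of type D is a sequence $\lambda_1>\dots>\lambda_r\ge0$, of length $r$ (a last part $0$ counts), and its underlying strict partition is obtained by dropping a part $0$. For $\lambda$ of type D, $\lambda(+)=(\lambda_1+1,\dots,\lambda_r+1)$. For $\mu$ strict, $P_\mu=\mathrm{Pf}^B_\mu(1,\dots,1)\in\Gamma'$; for $\mu$ of type D, $P_\mu$ is that of the underlying strict partition. For $\lambda$ strict, $\mathbb P_\lambda(t)=\mathrm{Pf}^B_\lambda(c)$ with $c(k)=\prod_{j=1}^{\lambda_k-1}(1+t_j)$;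 for $\lambda$ of type D, $\mathbb R_\lambda(t)=\mathrm{Pf}^D_\lambda(c)$ with $c(k)=\prod_{j=1}^{\lambda_k}(1+t_j)$. **Triples.** A triple $\tau$ of type D consists of integers $0<k_1<\dots<k_s$, $p_1\ge\dots\ge p_s\ge0$ and $q_1\ge\dots\ge q_s\ge 0$ with $(p_i-p_{i+1})+(q_i-q_{i+1})>k_{i+1}-k_i$ for $1\le i<s$; a triple of type B (or C) is one with all $p_i,q_i>0$. Put $r=k_s$. For $1\le m\le r$ let $i=i(m)$ be least with $m\le k_i$. In type D put $\lambda_m=p_i+q_i+k_i-m$ and $c(m)=\prod_{j=1}^{p_i}(1+x_j)\prod_{j=1}^{q_i}(1+y_j)$, and let $R_\tau(x,y)=\mathrm{Pf}^D_\lambda(c)$. In type B put $\lambda_m=p_i+q_i-1+k_i-m$ and $c(m)=\prod_{j=1}^{p_i-1}(1+x_j)\prod_{j=1}^{q_i-1}(1+y_j)$, and let $P_\tau(x,y)=\mathrm{Pf}^B_\lambda(c)$. The triple $\tau(+)$ of type B is obtained from a triple $\tau$ of type D by adding $1$ to every $p_i$ and every $q_i$. The signed permutation $w(\tau)$ of a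 triple of type B or C is constructed in steps $i=1,\dots,s$: take the $k_i-k_{i-1}$ (with $k_0=0$) smallest values $\ge q_i$ not used before and enter them with bars, in decreasing order of absolute value, in the first free positions $\ge p_i$; after step $s$, fill the free positions with the unused positive integers, unbarred, in increasing order. For a triple of type D the construction is the same with values $>q_i$ and positions $>p_i$. **Theorem.** 1. Let $\lambda$ be a partition of type D. There are unique finite expansions $$\mathbb P_{\lambda(+)}(t)=\sum_{\nu}p_{\lambda(+)}^{\nu}(t)\,P_\nu\ \ (\nu\text{ strict}),\qquad \mathbb R_\lambda(t)=\sum_{\mu}r_\lambda^\mu(t)\,P_\mu$$ with coefficients in $\mathbb Z[t]$, where $\mu$ runs over the partitions of type D whose length has the same parity as that of $\lambda$ (every strict partition underlies exactly one such $\mu$). For all these $\mu$, $$r_\lambda^\mu(t)=p_{\lambda(+)}^{\mu(+)}(t).$$ 2. Let $\tau$ be a triple of type D. There are likewise unique finite expansions $P_{\tau(+)}(x,y)=\sum_\nu p_{\tau(+)}^\nu(x,y)P_\nu$ and $R_\tau(x,y)=\sum_\mu r_\tau^\mu(x,y)P_\mu$ with coefficients in $\mathbb Z[x,y]$, where $\nu$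 is strict and $\mu$ is of type D with length of the same parity as $k_s$ (and as $0$ if $s=0$). For all these $\mu$, $$r_\tau^\mu(x,y)=p_{\tau(+)}^{\mu(+)}(x,y),$$ and moreover $w(\tau(+))=w(\tau)$. -/

import Mathlib

open scoped PowerSeries

noncomputable section

namespace TypeBD

/-! ### The ring `Γ'` -/

/-- The generators `P_k` (with `P_0 = 1`) of the polynomial ring `ℤ[P_1, P_2, …]`;
the variable of index `i` is `P_{i+1}`. -/
def genP : ℕ → MvPolynomial ℕ ℤ
  | 0 => 1
  | k + 1 => MvPolynomial.X k

/-- The relation `P_k² + 2 ∑_{j=1}^{k-1} (-1)^j P_{k+j} P_{k-j} + (-1)^k P_{2k}`. -/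
def relP (k : ℕ) : MvPolynomial ℕ ℤ :=
  genP k ^ 2 + 2 * ∑ j ∈ Finset.Icc 1 (k - 1), (-1) ^ j * genP (k + j) * genP (k - j)
    + (-1) ^ k * genP (2 * k)

/-- The ring `Γ' = ℤ[P_1, P_2, …] / (relP k, k ≥ 1)`. -/
abbrev Gam : Type :=
  MvPolynomial ℕ ℤ ⧸ Ideal.span {f : MvPolynomial ℕ ℤ | ∃ k : ℕ, 1 ≤ k ∧ f = relP k}

/-- The class of `P_k` in `Γ'`. -/
def P (k : ℕ) : Gam := Ideal.Quotient.mk _ (genP k)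

/-! ### Pfaffians -/

/-- The Pfaffian of a skew-symmetric matrix of even size, by expansion along the first row. -/
def pfaffian {R : Type*} [CommRing R] : {n : ℕ} → Matrix (Fin n) (Fin n) R → R
  | 0, _ => 1
  | 1, _ => 0
  | n + 2, M => ∑ k : Fin (n + 1), (-1) ^ (k : ℕ) * M 0 k.succ *
      pfaffian (n := n) (M.submatrix (fun i => (k.succAbove i).succ) (fun i => (k.succAbove i).succ))

/-- The Pfaffian of a skew-symmetric `r × r` matrix `M` together with elements `m_1, …, m_r`:
for `r` even it is the usual Pfaffian of `M`; for `r` odd it is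
`∑_k (-1)^{k-1} m_k Pf(M_k)`, where `M_k` is `M` without its `k`-th row and column. -/
def pfaffianExt {R : Type*} [CommRing R] :
    {r : ℕ} → (Fin r → R) → Matrix (Fin r) (Fin r) R → R
  | 0, _, _ => 1
  | r + 1, m, M =>
      if Even (r + 1) then pfaffian M
      else ∑ k : Fin (r + 1), (-1) ^ (k : ℕ) * m k *
        pfaffian (M.submatrix k.succAbove k.succAbove)

/-! ### Multi-Schur Pfaffians of types B and D

A graded series `c = c_0 + c_1 + c_2 + …` in a `Γ'`-algebra `R` is written as the power series
`∑ c_i X^i`, so that `PowerSeries.coeff i c` is its term of degree `i`. -/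

section Pf

variable (R : Type*) [CommRing R] [Algebra Gam R]

/-- The series `P_1 + P_2 + …`. -/
def Pplus : R⟦X⟧ :=
  PowerSeries.mk fun k => if k = 0 then 0 else algebraMap Gam R (P k)

/-- The series `Q = 1 + Q_1 + Q_2 + …`, where `Q_k = 2 P_k` for `k ≥ 1`. -/
def Qser : R⟦X⟧ := 1 + 2 * Pplus R

variable {R}

/-- The term of degree `m` of `(P_1 + P_2 + …) · c`, that is
`(1/2) ((Q · c)_m - c_m)`, written without denominators. -/
def half (c : R⟦X⟧) (m : ℕ) : R := PowerSeries.coeff m (Pplus R * c)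

/-- The term of degree `m` of `Q · c`. -/
def full (c : R⟦X⟧) (m : ℕ) : R := PowerSeries.coeff m (Qser R * c)

theorem full_eq (c : R⟦X⟧) (m : ℕ) : full c m = 2 * half c m + PowerSeries.coeff m c := by
  have h : Qser R * c = Pplus R * c + Pplus R * c + c := by
    unfold Qser; ring
  unfold full half
  rw [h, map_add, map_add]; ring

/-- The type B entry
`(1/4) (b_k b'_l + 2 ∑_{j=1}^l (-1)^j b_{k+j} b'_{l-j})`, where `b = Q · c`, `b' = Q · c'`, and
`c`, `c'` have degree less than `k`, `l`; see `four_mul_entryB`. -/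
def entryB (k l : ℕ) (c c' : R⟦X⟧) : R :=
  half c k * half c' l +
    ∑ j ∈ Finset.Icc 1 l, (-1) ^ j * half c (k + j) * full c' (l - j)

theorem four_mul_entryB (k l : ℕ) (c c' : R⟦X⟧)
    (hc : ∀ m, k ≤ m → PowerSeries.coeff m c = 0) (hc' : ∀ m, l ≤ m → PowerSeries.coeff m c' = 0) :
    4 * entryB k l c c' = full c k * full c' l +
      2 * ∑ j ∈ Finset.Icc 1 l, (-1) ^ j * full c (k + j) * full c' (l - j) := by
  unfold entryB
  rw [mul_add, Finset.mul_sum, Finset.mul_sum, full_eq c k, full_eq c' l, hc k le_rfl,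
    hc' l le_rfl]
  congr 1
  · ring
  · refine Finset.sum_congr rfl fun j _ => ?_
    rw [full_eq c (k + j), hc (k + j) (Nat.le_add_right k j)]; ring

/-- The type D entry
`(1/4) ((d_k - c_k) (d'_l + c'_l) + 2 ∑_{j=1}^l (-1)^j d_{k+j} d'_{l-j})`, where `d = Q · c`,
`d' = Q · c'`, and `c`, `c'` have degree at most `k`, `l`; see `four_mul_entryD`. -/
def entryD (k l : ℕ) (c c' : R⟦X⟧) : R :=
  half c k * (half c' l + PowerSeries.coeff l c') +
    ∑ j ∈ Finset.Icc 1 l, (-1) ^ j * half c (k + j) * full c' (l - j)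

theorem four_mul_entryD (k l : ℕ) (c c' : R⟦X⟧)
    (hc : ∀ m, k < m → PowerSeries.coeff m c = 0) :
    4 * entryD k l c c' =
      (full c k - PowerSeries.coeff k c) * (full c' l + PowerSeries.coeff l c') +
      2 * ∑ j ∈ Finset.Icc 1 l, (-1) ^ j * full c (k + j) * full c' (l - j) := by
  unfold entryD
  rw [mul_add, Finset.mul_sum, Finset.mul_sum, full_eq c k, full_eq c' l]
  congr 1
  · ring
  · refine Finset.sum_congr rfl fun j hj => ?_
    have hj1 : 1 ≤ j := (Finset.mem_Icc.mp hj).1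
    rw [full_eq c (k + j), hc (k + j) (by omega)]; ring

/-- The type B multi-Schur Pfaffian, `2^{-r} Pf_λ(Q · c(1), …, Q · c(r))`, for series `c(i)` of
degree less than `λ_i`. -/
def PfB {r : ℕ} (lam : Fin r → ℕ) (c : Fin r → R⟦X⟧) : R :=
  pfaffianExt (fun k => half (c k) (lam k))
    (Matrix.of fun k l => entryB (lam k) (lam l) (c k) (c l))

/-- The type D multi-Schur Pfaffian `2^{-r} Pf_λ(c(1)|d(1), …, c(r)|d(r))`, with
`d(i) = Q · c(i)`, for series `c(i)` of degree at most `λ_i`. The elements used for odd `r` are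
`(1/2) (d(k)_{λ_k} + c(k)_{λ_k})`. -/
def PfD {r : ℕ} (lam : Fin r → ℕ) (c : Fin r → R⟦X⟧) : R :=
  pfaffianExt (fun k => half (c k) (lam k) + PowerSeries.coeff (lam k) (c k))
    (Matrix.of fun k l => entryD (lam k) (lam l) (c k) (c l))

end Pf

/-! ### Partitions -/

/-- A strict partition `λ_1 > ⋯ > λ_r > 0`. -/
@[ext] structure StrictPartition where
  parts : List ℕ
  decreasing : parts.Pairwise (· > ·)
  pos : ∀ a ∈ parts, 0 < a

/-- A partition of type D, `λ_1 > ⋯ > λ_r ≥ 0`; its length is `r`, a last part `0` included. -/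
@[ext] structure PartitionD where
  parts : List ℕ
  decreasing : parts.Pairwise (· > ·)

/-- The length of a partition of type D. -/
def PartitionD.length (lam : PartitionD) : ℕ := lam.parts.length

/-- The strict partition underlying a partition of type D (a last part `0` is dropped). -/
def PartitionD.strict (lam : PartitionD) : StrictPartition where
  parts := lam.parts.filter (fun a => 0 < a)
  decreasing := lam.decreasing.filter _
  pos := fun a ha => by simpa using (List.mem_filter.mp ha).2

/-- `λ(+)`: add `1` to every part, including a last part `0`. -/
def PartitionD.plus (lam : PartitionD) : StrictPartition where
  parts := lam.parts.map (· + 1)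
  decreasing := by
    rw [List.pairwise_map]
    exact lam.decreasing.imp fun h => Nat.succ_lt_succ h
  pos := fun a ha => by
    obtain ⟨b, _, rfl⟩ := List.mem_map.mp ha
    exact Nat.succ_pos b

/-! ### The polynomials `P_μ`, `ℙ_λ(t)` and `ℝ_λ(t)` -/

/-- The basis element `P_μ` of `Γ'`, equal to `2^{-r} Pf_μ(Q, …, Q)`. -/
def Pbasis (mu : StrictPartition) : Gam :=
  PfB (R := Gam) mu.parts.get (fun _ => 1)

/-- The series `∏_{j=1}^n (1 + z_j)`, each `z_j` having degree one. -/
def chern {R : Type*} [CommRing R] (z : ℕ → R) (n : ℕ) : R⟦X⟧ :=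
  ∏ j ∈ Finset.range n, (1 + PowerSeries.C (z j) * PowerSeries.X)

/-- The ring `Γ'[t_1, t_2, …]`; the variable of index `i` is `t_{i+1}`. -/
abbrev GamT : Type := MvPolynomial ℕ Gam

/-- The ring `Γ'[x_1, x_2, …, y_1, y_2, …]`; the variables `x_{i+1}` and `y_{i+1}` have the
indices `Sum.inl i` and `Sum.inr i`. -/
abbrev GamXY : Type := MvPolynomial (ℕ ⊕ ℕ) Gam

/-- The type B polynomial `ℙ_λ(t)`, the Pfaffian for `∏_{j=1}^{λ_i - 1} (1 + t_j)`. -/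
def PPoly (lam : StrictPartition) : GamT :=
  PfB lam.parts.get (fun i => chern MvPolynomial.X (lam.parts.get i - 1))

/-- The type D polynomial `ℝ_λ(t)`, the Pfaffian for `∏_{j=1}^{λ_i} (1 + t_j)`. -/
def RPoly (lam : PartitionD) : GamT :=
  PfD lam.parts.get (fun i => chern MvPolynomial.X (lam.parts.get i))

/-- `f = ∑_μ a_μ P_μ`, a finite sum over strict partitions with integral polynomials `a_μ` as
coefficients. -/
def IsExpansion {σ : Type} (f : MvPolynomial σ Gam)
    (a : StrictPartition →₀ MvPolynomial σ ℤ) : Prop :=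
  f = a.sum fun mu b => MvPolynomial.map (Int.castRingHom Gam) b * MvPolynomial.C (Pbasis mu)

/-! ### Triples and their polynomials -/

/-- A triple of type D. The numbers `p_i`, `q_i` may be zero. -/
structure TripleD where
  s : ℕ
  k : Fin s → ℕ
  p : Fin s → ℕ
  q : Fin s → ℕ
  k_pos : ∀ i, 0 < k i
  k_strictMono : StrictMono k
  p_antitone : Antitone p
  q_antitone : Antitone q
  star : ∀ i j : Fin s, (j : ℕ) = i + 1 →
    ((p i : ℤ) - p j) + ((q i : ℤ) - q j) > (k j : ℤ) - k i

/-- A triple of type C (equivalently, of type B): the same, with all `p_i`, `q_i` positive. -/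
structure TripleC extends TripleD where
  p_pos : ∀ i, 0 < p i
  q_pos : ∀ i, 0 < q i

/-- `τ(+)`: add `1` to each `p_i` and each `q_i`. -/
def TripleD.plus (t : TripleD) : TripleC where
  s := t.s
  k := t.k
  p := fun i => t.p i + 1
  q := fun i => t.q i + 1
  k_pos := t.k_pos
  k_strictMono := t.k_strictMono
  p_antitone := fun _ _ h => Nat.succ_le_succ (t.p_antitone h)
  q_antitone := fun _ _ h => Nat.succ_le_succ (t.q_antitone h)
  star := fun i j h => by have := t.star i j h; push_cast; linarith
  p_pos := fun _ => Nat.succ_pos _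
  q_pos := fun _ => Nat.succ_pos _

/-- `r = k_s`, the largest of the `k_i` (and `0` for the empty triple). -/
def TripleD.r (t : TripleD) : ℕ := Finset.univ.sup t.k

theorem TripleD.block_nonempty (t : TripleD) (m : Fin t.r) :
    (Finset.univ.filter fun i : Fin t.s => (m : ℕ) + 1 ≤ t.k i).Nonempty := by
  obtain ⟨i, _, hi⟩ := (Finset.lt_sup_iff).mp m.2
  exact ⟨i, by simpa using hi⟩

/-- For `1 ≤ m + 1 ≤ r`, the least index `i` with `m + 1 ≤ k_i`. -/
def TripleD.block (t : TripleD) (m : Fin t.r) : Fin t.s :=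
  (Finset.univ.filter fun i : Fin t.s => (m : ℕ) + 1 ≤ t.k i).min' (t.block_nonempty m)

/-- The partition `λ(τ)` of type D: `λ_m = p_i + q_i + k_i - m` for `i` least with `m ≤ k_i`. -/
def TripleD.lam (t : TripleD) (m : Fin t.r) : ℕ :=
  t.p (t.block m) + t.q (t.block m) + (t.k (t.block m) - ((m : ℕ) + 1))

/-- The strict partition `λ(τ)` of type C: `λ_m = p_i + q_i - 1 + k_i - m` for `i` least with
`m ≤ k_i`. -/
def TripleC.lam (t : TripleC) (m : Fin t.r) : ℕ :=
  t.p (t.block m) + t.q (t.block m) - 1 + (t.k (t.block m) - ((m : ℕ) + 1))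

/-- The series `∏_{j=1}^a (1 + x_j) ∏_{j=1}^b (1 + y_j)`. -/
def chernXY (a b : ℕ) : GamXY⟦X⟧ :=
  chern (fun j => MvPolynomial.X (Sum.inl j)) a * chern (fun j => MvPolynomial.X (Sum.inr j)) b

/-- The type B polynomial `P_τ(x, y)`. -/
def TripleC.PPoly (t : TripleC) : GamXY :=
  PfB t.lam (fun m => chernXY (t.p (t.block m) - 1) (t.q (t.block m) - 1))

/-- The type D polynomial `R_τ(x, y)`. -/
def TripleD.RPoly (t : TripleD) : GamXY :=
  PfD t.lam (fun m => chernXY (t.p (t.block m)) (t.q (t.block m)))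

/-! ### Signed permutations -/

/-- A signed permutation `w`: the value at a positive integer `a` is `w(a)`, barred integers being
negative. (The value `w(0) = 0` carries no information.) -/
@[ext] structure SignedPerm where
  toFun : ℕ → ℤ
  map_zero : toFun 0 = 0
  bijective : Function.Bijective fun a => (toFun a).natAbs
  finite : {a : ℕ | toFun a ≠ a}.Finite

/-- A finite matching of positions with values: `(a, b)` in the list means that the barred
integer `b` stands in position `a`. -/
structure Barring where
  pairs : List (ℕ × ℕ)
  pos_nodup : (pairs.map Prod.fst).Nodup
  val_nodup : (pairs.map Prod.snd).Nodup
  pos_pos : 0 ∉ pairs.map Prod.fst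
  val_pos : 0 ∉ pairs.map Prod.snd

/-- `a` is a free position. -/
def Barring.FreePos (B : Barring) (a : ℕ) : Prop := a ∉ B.pairs.map Prod.fst

/-- `b` is an unused value. -/
def Barring.FreeVal (B : Barring) (b : ℕ) : Prop := b ∉ B.pairs.map Prod.snd

theorem infinite_free (L : List ℕ) (m : ℕ) : {a : ℕ | (m ≤ a ∧ 0 < a) ∧ a ∉ L}.Infinite := by
  have h : (Set.Ici (m + 1) \ {a : ℕ | a ∈ L}).Infinite :=
    (Set.Ici_infinite (m + 1)).sdiff (List.finite_toSet L)
  refine h.mono fun a ha => ⟨⟨?_, ?_⟩, ha.2⟩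
  · exact (Nat.le_succ m).trans ha.1
  · exact (Nat.succ_pos m).trans_le ha.1

/-- Enter `n` further barred integers: the `n` smallest unused values that are at least `v`, in
decreasing order, in the first `n` free positions that are at least `u`. -/
def Barring.insert (B : Barring) (u v n : ℕ) : Barring where
  pairs := B.pairs ++ (List.range n).map fun j =>
    (Nat.nth (fun a => (u ≤ a ∧ 0 < a) ∧ B.FreePos a) j,
      Nat.nth (fun b => (v ≤ b ∧ 0 < b) ∧ B.FreeVal b) (n - 1 - j))
  pos_nodup := by
    have hinf := infinite_free (B.pairs.map Prod.fst) u
    rw [List.map_append, List.map_map]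
    refine List.Nodup.append B.pos_nodup ?_ ?_
    · exact List.Nodup.map (Nat.nth_injective hinf) List.nodup_range
    · intro a ha hb
      obtain ⟨j, _, rfl⟩ := List.mem_map.mp hb
      exact (Nat.nth_mem_of_infinite hinf j).2 ha
  val_nodup := by
    have hinf := infinite_free (B.pairs.map Prod.snd) v
    rw [List.map_append, List.map_map]
    refine List.Nodup.append B.val_nodup ?_ ?_
    · refine List.Nodup.map_on ?_ List.nodup_range
      intro i hi j hj hij
      have := Nat.nth_injective hinf hij
      rw [List.mem_range] at hi hj
      omega
    · intro a ha hb
      obtain ⟨j, _, rfl⟩ := List.mem_map.mp hb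
      exact (Nat.nth_mem_of_infinite hinf _).2 ha
  pos_pos := by
    have hinf := infinite_free (B.pairs.map Prod.fst) u
    rw [List.map_append, List.map_map, List.mem_append]
    rintro (h | h)
    · exact B.pos_pos h
    · obtain ⟨j, _, hj⟩ := List.mem_map.mp h
      have := (Nat.nth_mem_of_infinite hinf j).1.2
      exact absurd hj (Nat.ne_of_gt this)
  val_pos := by
    have hinf := infinite_free (B.pairs.map Prod.snd) v
    rw [List.map_append, List.map_map, List.mem_append]
    rintro (h | h)
    · exact B.val_pos h
    · obtain ⟨j, _, hj⟩ := List.mem_map.mp h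
      have := (Nat.nth_mem_of_infinite hinf (n - 1 - j)).1.2
      exact absurd hj (Nat.ne_of_gt this)

open Classical in
/-- The sign-free part of the completed permutation: position `a` receives its barred value, or,
if it is free, the unused value that has as many unused values below it as `a` has free positions
below it. -/
def Barring.absFun (B : Barring) (a : ℕ) : ℕ :=
  if h : ∃ b, (a, b) ∈ B.pairs then h.choose else Nat.nth B.FreeVal (Nat.count B.FreePos a)

theorem Barring.freePos_iff (B : Barring) (a : ℕ) : B.FreePos a ↔ ¬ ∃ b, (a, b) ∈ B.pairs := by
  simp [Barring.FreePos]

theorem Barring.absFun_of_mem (B : Barring) {a b : ℕ} (h : (a, b) ∈ B.pairs) :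
    B.absFun a = b := by
  have hex : ∃ b, (a, b) ∈ B.pairs := ⟨b, h⟩
  rw [Barring.absFun, dif_pos hex]
  have := List.inj_on_of_nodup_map B.pos_nodup hex.choose_spec h rfl
  exact (Prod.ext_iff.mp this).2

open Classical in
theorem Barring.absFun_of_free (B : Barring) {a : ℕ} (h : B.FreePos a) :
    B.absFun a = Nat.nth B.FreeVal (Nat.count B.FreePos a) := by
  rw [Barring.absFun, dif_neg ((B.freePos_iff a).mp h)]

theorem infinite_notMem (L : List ℕ) : {a : ℕ | a ∉ L}.Infinite :=
  (infinite_free L 0).mono fun _ ha => ha.2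

open Classical in
theorem count_notMem (L : List ℕ) (hL : L.Nodup) (n : ℕ) (hn : ∀ a ∈ L, a < n) :
    Nat.count (fun a => a ∉ L) n + L.length = n := by
  rw [Nat.count_eq_card_filter_range]
  have h1 : (Finset.range n).filter (fun a => a ∉ L) = Finset.range n \ L.toFinset := by
    ext a; simp
  have h2 : L.toFinset ⊆ Finset.range n := fun a ha => by
    simpa using hn a (by simpa using ha)
  rw [h1, ← List.toFinset_card_of_nodup hL]
  simpa using Finset.card_sdiff_add_card_eq_card h2

theorem Barring.absFun_bijective (B : Barring) : Function.Bijective B.absFun := by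
  classical
  have hP : {a | B.FreePos a}.Infinite := infinite_notMem _
  have hV : {a | B.FreeVal a}.Infinite := infinite_notMem _
  constructor
  · intro a a' h
    by_cases ha : B.FreePos a <;> by_cases ha' : B.FreePos a'
    · rw [B.absFun_of_free ha, B.absFun_of_free ha'] at h
      exact Nat.count_injective ha ha' (Nat.nth_injective hV h)
    · obtain ⟨b', hb'⟩ := not_not.mp (mt (B.freePos_iff a').mpr ha')
      rw [B.absFun_of_free ha, B.absFun_of_mem hb'] at h
      have := Nat.nth_mem_of_infinite hV (Nat.count B.FreePos a)
      rw [h] at this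
      exact absurd (List.mem_map.mpr ⟨_, hb', rfl⟩) this
    · obtain ⟨b, hb⟩ := not_not.mp (mt (B.freePos_iff a).mpr ha)
      rw [B.absFun_of_free ha', B.absFun_of_mem hb] at h
      have := Nat.nth_mem_of_infinite hV (Nat.count B.FreePos a')
      rw [← h] at this
      exact absurd (List.mem_map.mpr ⟨_, hb, rfl⟩) this
    · obtain ⟨b, hb⟩ := not_not.mp (mt (B.freePos_iff a).mpr ha)
      obtain ⟨b', hb'⟩ := not_not.mp (mt (B.freePos_iff a').mpr ha')
      rw [B.absFun_of_mem hb, B.absFun_of_mem hb'] at h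
      have := List.inj_on_of_nodup_map B.val_nodup hb hb' h
      exact (Prod.ext_iff.mp this).1
  · intro b
    by_cases hb : B.FreeVal b
    · refine ⟨Nat.nth B.FreePos (Nat.count B.FreeVal b), ?_⟩
      rw [B.absFun_of_free (Nat.nth_mem_of_infinite hP _), Nat.count_nth_of_infinite hP,
        Nat.nth_count hb]
    · obtain ⟨⟨a, b'⟩, hab, rfl⟩ := List.mem_map.mp (not_not.mp hb)
      exact ⟨a, B.absFun_of_mem hab⟩

theorem Barring.absFun_eventually (B : Barring) :
    ∃ N, ∀ a, N ≤ a → B.FreePos a ∧ B.absFun a = a := by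
  classical
  refine ⟨(B.pairs.map Prod.fst).sum + (B.pairs.map Prod.snd).sum + 1, fun a ha => ?_⟩
  have h1 : ∀ x ∈ B.pairs.map Prod.fst, x < a := fun x hx => by
    have := List.le_sum_of_mem hx; omega
  have h2 : ∀ x ∈ B.pairs.map Prod.snd, x < a := fun x hx => by
    have := List.le_sum_of_mem hx; omega
  have hP : B.FreePos a := fun h => lt_irrefl _ (h1 a h)
  have hV : B.FreeVal a := fun h => lt_irrefl _ (h2 a h)
  refine ⟨hP, ?_⟩
  have e1 := count_notMem _ B.pos_nodup a h1
  have e2 := count_notMem _ B.val_nodup a h2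
  rw [List.length_map] at e1 e2
  have e1' : Nat.count B.FreePos a + B.pairs.length = a := by convert e1
  have e2' : Nat.count B.FreeVal a + B.pairs.length = a := by convert e2
  have e3 : Nat.count B.FreePos a = Nat.count B.FreeVal a := by omega
  rw [B.absFun_of_free hP, e3, Nat.nth_count hV]

open Classical in
/-- The signed permutation with the given barred integers in the given positions, and the
remaining positive integers, unbarred and in increasing order, in the remaining positions. -/
def Barring.toSignedPerm (B : Barring) : SignedPerm where
  toFun := fun a => if B.FreePos a then (B.absFun a : ℤ) else -(B.absFun a : ℤ)
  map_zero := by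
    have h0 : B.FreePos 0 := B.pos_pos
    have h0' : B.FreeVal 0 := B.val_pos
    rw [if_pos h0, B.absFun_of_free h0, Nat.count_zero]
    have := Nat.nth_count h0'
    rw [Nat.count_zero] at this
    simpa using this
  bijective := by
    have h : (fun a => (if B.FreePos a then (B.absFun a : ℤ) else -(B.absFun a : ℤ)).natAbs) =
        B.absFun := by
      funext a; split_ifs <;> simp
    rw [h]
    exact B.absFun_bijective
  finite := by
    obtain ⟨N, hN⟩ := B.absFun_eventually
    refine (Set.finite_lt_nat N).subset fun a ha => ?_
    by_contra hlt
    obtain ⟨h1, h2⟩ := hN a (not_lt.mp hlt)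
    exact ha (by simp [h1, h2])

/-- No barred integers. -/
def Barring.empty : Barring := ⟨[], by simp, by simp, by simp, by simp⟩

/-- The barred integers entered in the first `n` steps of the construction for a triple of
type C: in step `i`, barred integers with values at least `q_i` are entered in positions at least
`p_i`, so that `k_i` of them have been entered in all. -/
def TripleC.barring (t : TripleC) : ℕ → Barring
  | 0 => Barring.empty
  | n + 1 =>
      if h : n < t.s then
        (t.barring n).insert (t.p ⟨n, h⟩) (t.q ⟨n, h⟩) (t.k ⟨n, h⟩ - (t.barring n).pairs.length)
      else t.barring n

/-- The signed permutation `w(τ)` of a triple of type C. -/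
def TripleC.w (t : TripleC) : SignedPerm := (t.barring t.s).toSignedPerm

/-- The barred integers entered in the first `n` steps of the construction for a triple of
type D: in step `i`, barred integers with values greater than `q_i` are entered in positions
greater than `p_i`, so that `k_i` of them have been entered in all. -/
def TripleD.barring (t : TripleD) : ℕ → Barring
  | 0 => Barring.empty
  | n + 1 =>
      if h : n < t.s then
        (t.barring n).insert (t.p ⟨n, h⟩ + 1) (t.q ⟨n, h⟩ + 1)
          (t.k ⟨n, h⟩ - (t.barring n).pairs.length)
      else t.barring n

/-- The signed permutation `w(τ)` of a triple of type D. -/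
def TripleD.w (t : TripleD) : SignedPerm := (t.barring t.s).toSignedPerm

end TypeBD

end

open scoped PowerSeries Polynomial

noncomputable section

namespace TypeBD

/-! ### Pfaffians and the exterior algebra -/

section Exterior

open CliffordAlgebra ExteriorAlgebra

variable {R V : Type*} [CommRing R] [AddCommGroup V] [Module R V]

/-! For an alternating form B, the Pfaffian of the matrix (B(v_i, v_j)) is a linear form evaluated
at the product v_1 ∧ ⋯ ∧ v_r in the exterior algebra; for odd r the same holds with an additional
linear form m (`pfaffianExt_eq_pfExtForm`). Here the module is free on e_0, e_1, …, with m(e_k) =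
P_k and B(e_k, e_l) given by `skewEntry`. The defining relations of Γ' say that B(e_k, e_k) = 0 for
k ≥ 1, and this forces B to be alternating. A type D Pfaffian is the value at the product of the
vectors v_i = ∑_a c(i)_a e_{λ_i - a} (`PfD_eq_pfExtForm`); a type B Pfaffian is the same thing when
the coefficient of e_0 vanishes.

Raising every λ_i by 1 with c(i) fixed replaces each e_k by e_{k+1}. So the product of the v_i is
expanded once, over the integral polynomial ring, as ∑ a_μ e_μ with μ of type D and of length r.
After the shift e_μ takes the value P_{μ(+)}; without the shift it takes the value P_μ, because a
last e_0 may be dropped (`homPf_append_zero`). Both expansions therefore have the coefficients a_μ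
(`exists_expansions`).

Uniqueness is the linear independence of the P_ν over ℤ. Multiplication of Q(z) by (1 + uz)/(1 - uz)
defines a homomorphism from Γ' to Γ'[u]. For nonempty ν the image of P_ν has degree at most ν_1 in
u, and its coefficient at u^{ν_1} is P of ν without its first part (`coeff_adjoinHom_Pbasis`).
Induction on the largest part concludes.

The signed permutations agree because values and positions > a are those ≥ a + 1. -/

theorem toQuadraticMap_neg_eq_zero {B : LinearMap.BilinForm R V} (hB : B.IsAlt) :
    (-B).toQuadraticMap = (0 : QuadraticForm R V) - 0 := by
  ext v
  simp [hB v]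

/-- The Pfaffian of an alternating form, as a linear form on the exterior algebra. -/
def pfForm {B : LinearMap.BilinForm R V} (hB : B.IsAlt) : ExteriorAlgebra R V →ₗ[R] R :=
  (algebraMapInv (R := R) (M := V)).toLinearMap ∘ₗ changeForm (toQuadraticMap_neg_eq_zero hB)

/-- Contraction of the exterior algebra by a linear form. -/
abbrev contr (d : Module.Dual R V) : ExteriorAlgebra R V →ₗ[R] ExteriorAlgebra R V :=
  contractLeft (Q := (0 : QuadraticForm R V)) d

theorem pfForm_one {B : LinearMap.BilinForm R V} (hB : B.IsAlt) : pfForm hB 1 = 1 := by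
  simp [pfForm]

/-- The recursion of `changeForm` for -B has two terms. The projection to scalars kills the first,
and the second is the expansion of a Pfaffian along its first row. -/
theorem pfForm_ι_mul {B : LinearMap.BilinForm R V} (hB : B.IsAlt) (v : V)
    (x : ExteriorAlgebra R V) : pfForm hB (ExteriorAlgebra.ι R v * x) = pfForm hB (contr (B v) x) := by
  have h : algebraMapInv (ExteriorAlgebra.ι R v) = 0 := by
    simp [algebraMapInv]
  unfold pfForm contr
  simp only [LinearMap.comp_apply, AlgHom.toLinearMap_apply]
  rw [changeForm_ι_mul, changeForm_contractLeft, map_sub, map_mul]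
  erw [h]
  simp

theorem contr_ιMulti (d : Module.Dual R V) :
    ∀ {n : ℕ} (v : Fin (n + 1) → V), contr d (ιMulti R (n + 1) v) =
      ∑ k : Fin (n + 1), ((-1) ^ (k : ℕ) * d (v k)) • ιMulti R n (fun i => v (k.succAbove i))
  | 0, v => by
    simp only [ιMulti_succ_apply, ιMulti_zero_apply, contr]
    rw [contractLeft_ι_mul]
    simp
  | n + 1, v => by
    rw [ιMulti_succ_apply, contr, contractLeft_ι_mul, Fin.sum_univ_succ]
    have ih := contr_ιMulti d (Matrix.vecTail v)
    unfold contr at ih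
    erw [ih]
    rw [Finset.mul_sum, sub_eq_add_neg, ← Finset.sum_neg_distrib]
    congr 1
    · simp [Matrix.vecTail, Function.comp_def]
    · refine Finset.sum_congr rfl fun k _ => ?_
      rw [ιMulti_succ_apply]
      simp [Matrix.vecTail, Function.comp_def, pow_succ]

theorem pfaffian_eq_pfForm {B : LinearMap.BilinForm R V} (hB : B.IsAlt) :
    ∀ {n : ℕ} (v : Fin n → V),
      pfaffian (Matrix.of fun i j => B (v i) (v j)) = pfForm hB (ιMulti R n v)
  | 0, v => by simp [pfaffian, pfForm_one]
  | 1, v => by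
    rw [ιMulti_succ_apply, pfForm_ι_mul]
    simp [pfaffian, contr, contractLeft_one]
  | n + 2, v => by
    rw [ιMulti_succ_apply, pfForm_ι_mul, contr_ιMulti, map_sum, pfaffian]
    refine Finset.sum_congr rfl fun k _ => ?_
    rw [map_smul, ← pfaffian_eq_pfForm hB, smul_eq_mul]
    rfl

/-- The linear form on the exterior algebra that gives the extended Pfaffians of size `r`. -/
def pfExtForm {B : LinearMap.BilinForm R V} (hB : B.IsAlt) (m : Module.Dual R V) (r : ℕ) :
    ExteriorAlgebra R V →ₗ[R] R :=
  if Even r then pfForm hB else pfForm hB ∘ₗ contr m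

theorem pfaffianExt_eq_pfExtForm {B : LinearMap.BilinForm R V} (hB : B.IsAlt)
    (m : Module.Dual R V) {r : ℕ} (v : Fin r → V) :
    pfaffianExt (fun i => m (v i)) (Matrix.of fun i j => B (v i) (v j)) =
      pfExtForm hB m r (ιMulti R r v) := by
  cases r with
  | zero => simp [pfaffianExt, pfExtForm, pfForm_one]
  | succ r =>
    rw [pfaffianExt, pfExtForm]
    split_ifs with h
    · exact pfaffian_eq_pfForm hB v
    · rw [LinearMap.comp_apply, contr_ιMulti, map_sum]
      refine Finset.sum_congr rfl fun k _ => ?_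
      rw [map_smul, ← pfaffian_eq_pfForm hB, smul_eq_mul]
      rfl

end Exterior

/-! ### The skew form attached to a sequence -/

section SkewEntry

variable {R S : Type*} [CommRing R] [CommRing S]

/-- The sequence `1, 2 p_1, 2 p_2, …`. -/
def doubleSeq (p : ℕ → R) (k : ℕ) : R := if k = 0 then 1 else 2 * p k

/-- `p_k p_l + ∑_{j=1}^l (-1)^j p_{k+j} q_{l-j}` with `q = 1, 2 p_1, 2 p_2, …`, the first term
being omitted for `k = 0`. -/
def skewEntry (p : ℕ → R) (k l : ℕ) : R :=
  (if k = 0 then 0 else p k) * p l +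
    ∑ j ∈ Finset.Icc 1 l, (-1) ^ j * p (k + j) * doubleSeq p (l - j)

theorem map_skewEntry (f : R →+* S) (p : ℕ → R) (k l : ℕ) :
    f (skewEntry p k l) = skewEntry (fun i => f (p i)) k l := by
  simp [skewEntry, doubleSeq, apply_ite f, map_ofNat]

theorem sum_Icc_one_succ (f : ℕ → R) (l : ℕ) :
    ∑ j ∈ Finset.Icc 1 (l + 1), f j = f 1 + ∑ j ∈ Finset.Icc 1 l, f (j + 1) := by
  induction l with
  | zero => simp
  | succ l ih =>
    rw [Finset.sum_Icc_succ_top (by omega), ih, Finset.sum_Icc_succ_top (by omega), add_assoc]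

/-- Up to its first term, the first sum reindexed by one is minus the second sum. Together with
`skewEntry_one` this recurrence determines all entries with positive indices. -/
theorem skewEntry_add (p : ℕ → R) (k l : ℕ) :
    skewEntry p (k + 1) (l + 2) + skewEntry p (k + 2) (l + 1) =
      p (k + 1) * p (l + 2) - p (k + 2) * p (l + 1) := by
  have h : ∑ j ∈ Finset.Icc 1 (l + 2), (-1) ^ j * p (k + 1 + j) * doubleSeq p (l + 2 - j) =
      -(p (k + 2) * (2 * p (l + 1))) -
        ∑ j ∈ Finset.Icc 1 (l + 1), (-1) ^ j * p (k + 2 + j) * doubleSeq p (l + 1 - j) := by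
    rw [sum_Icc_one_succ, sub_eq_add_neg, ← Finset.sum_neg_distrib]
    congr 1
    · simp [doubleSeq]
    · refine Finset.sum_congr rfl fun j _ => ?_
      rw [show k + 1 + (j + 1) = k + 2 + j by ring, show l + 2 - (j + 1) = l + 1 - j by omega,
        pow_succ]
      ring
  rw [skewEntry, skewEntry, h]
  simp only [Nat.add_eq_zero_iff, one_ne_zero, two_ne_zero, and_false, if_false]
  ring

theorem skewEntry_one (p : ℕ → R) (k : ℕ) :
    skewEntry p (k + 1) 1 = p (k + 1) * p 1 - p (k + 2) := by
  simp [skewEntry, doubleSeq, sub_eq_add_neg]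

theorem skewEntry_zero_right (p : ℕ → R) (h0 : p 0 = 1) (k : ℕ) :
    skewEntry p (k + 1) 0 = p (k + 1) := by
  simp [skewEntry, h0]

variable {p : ℕ → R} (hp : ∀ k, skewEntry p (k + 1) (k + 1) = 0)
include hp

/-- The right side of `skewEntry_add` is antisymmetric in the two indices, so the symmetrized
entries at index gaps d + 2 and d agree up to sign. Gap 0 is the hypothesis, and gap 1 is the
recurrence with k = l. -/
theorem skewEntry_skew_pos (k l : ℕ) :
    skewEntry p (k + 1) (l + 1) + skewEntry p (l + 1) (k + 1) = 0 := by
  have key : ∀ d k, (skewEntry p (k + 1) (k + d + 1) + skewEntry p (k + d + 1) (k + 1) = 0) := by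
    intro d
    induction d using Nat.strong_induction_on with
    | _ d ih =>
      intro k
      match d, ih with
      | 0, _ => simp [hp k]
      | 1, _ =>
        have := skewEntry_add p k k
        rw [show k + 2 = k + 1 + 1 by rfl] at this ⊢
        rw [this]; ring
      | d + 2, ih =>
        have h1 := skewEntry_add p k (k + d + 1)
        have h2 := skewEntry_add p (k + d + 1) k
        have h3 := ih d (by omega) (k + 1)
        rw [show k + 1 + d + 1 = k + d + 2 by ring, show k + 1 + 1 = k + 2 by ring] at h3
        rw [show k + d + 1 + 1 = k + d + 2 by ring, show k + d + 1 + 2 = k + d + 3 by ring] at h1 h2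
        rw [show k + (d + 2) + 1 = k + d + 3 by ring]
        linear_combination h1 + h2 - h3
  rcases le_total k l with h | h
  · obtain ⟨d, rfl⟩ := Nat.exists_eq_add_of_le h
    exact key d k
  · obtain ⟨d, rfl⟩ := Nat.exists_eq_add_of_le h
    rw [add_comm]; exact key d l

/-- Shifting the sum reduces row 0 to row 1, where skew symmetry and `skewEntry_one` apply. That the
row of e_0 is -m on the other e_k is what later allows a last part 0 to be dropped. -/
theorem skewEntry_zero_left (l : ℕ) : skewEntry p 0 (l + 1) = -p (l + 1) := by
  cases l with
  | zero => simp [skewEntry, doubleSeq]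
  | succ l =>
    have h : skewEntry p 0 (l + 2) = -(p 1 * p (l + 1)) - skewEntry p 1 (l + 1) := by
      rw [skewEntry, skewEntry, sum_Icc_one_succ]
      have : ∑ j ∈ Finset.Icc 1 (l + 1), (-1) ^ (j + 1) * p (0 + (j + 1)) *
          doubleSeq p (l + 2 - (j + 1)) =
          - ∑ j ∈ Finset.Icc 1 (l + 1), (-1) ^ j * p (1 + j) * doubleSeq p (l + 1 - j) := by
        rw [← Finset.sum_neg_distrib]
        refine Finset.sum_congr rfl fun j _ => ?_
        rw [show 0 + (j + 1) = 1 + j by ring, show l + 2 - (j + 1) = l + 1 - j by omega, pow_succ]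
        ring
      rw [this]
      simp [doubleSeq]
      ring
    have h1 := skewEntry_skew_pos hp 0 l
    have h2 := skewEntry_one p l
    rw [zero_add] at h1
    rw [h]
    linear_combination -h1 + h2

theorem skewEntry_self (k : ℕ) : skewEntry p k k = 0 := by
  cases k with
  | zero => simp [skewEntry]
  | succ k => exact hp k

theorem skewEntry_skew (h0 : p 0 = 1) (k l : ℕ) : skewEntry p k l = -skewEntry p l k := by
  rw [eq_neg_iff_add_eq_zero]
  cases k with
  | zero =>
    cases l with
    | zero => simp [skewEntry_self hp]
    | succ l => rw [skewEntry_zero_left hp, skewEntry_zero_right p h0, neg_add_cancel]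
  | succ k =>
    cases l with
    | zero => rw [skewEntry_zero_left hp, skewEntry_zero_right p h0, add_neg_cancel]
    | succ l => exact skewEntry_skew_pos hp k l

end SkewEntry

section Form

variable {R : Type*} [CommRing R]

/-- The linear form on the free module with basis `e_0, e_1, …` with values `p_k` on `e_k`. -/
abbrev seqDual (p : ℕ → R) : Module.Dual R (ℕ →₀ R) := Finsupp.linearCombination R p

/-- The bilinear form with values `skewEntry p k l` on `(e_k, e_l)`. -/
def seqForm (p : ℕ → R) : LinearMap.BilinForm R (ℕ →₀ R) :=
  Finsupp.linearCombination R fun k => Finsupp.linearCombination R fun l => skewEntry p k l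

theorem seqForm_single (p : ℕ → R) (k l : ℕ) (a b : R) :
    seqForm p (Finsupp.single k a) (Finsupp.single l b) = a * b * skewEntry p k l := by
  simp [seqForm, mul_assoc]

theorem seqForm_skew {p : ℕ → R} (h0 : p 0 = 1) (hp : ∀ k, skewEntry p (k + 1) (k + 1) = 0)
    (v w : ℕ →₀ R) : seqForm p v w = -seqForm p w v := by
  induction v using Finsupp.induction_linear with
  | zero => simp
  | add v v' h h' => simp [h, h', add_comm]
  | single k a =>
    induction w using Finsupp.induction_linear with
    | zero => simp
    | add v v' h h' => simp [h, h', add_comm]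
    | single l b => rw [seqForm_single, seqForm_single, skewEntry_skew hp h0]; ring

/-- Since 2 may be a zero divisor, skew symmetry is not enough; the vanishing on basis vectors is
used as well. -/
theorem seqForm_isAlt {p : ℕ → R} (h0 : p 0 = 1) (hp : ∀ k, skewEntry p (k + 1) (k + 1) = 0) :
    (seqForm p).IsAlt := by
  intro v
  induction v using Finsupp.induction_linear with
  | zero => simp
  | add v v' h h' =>
    have := seqForm_skew h0 hp v v'
    simp [h, h', this]
  | single k a => rw [seqForm_single, skewEntry_self hp, mul_zero]

end Form

/-! ### The relations of Γ' as vanishing diagonal entries -/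

theorem P_zero : P 0 = 1 := by simp [P, genP]

/-- The last term of the sum contains q_0 = 1 rather than 2 P_0, which accounts for the coefficient
±1 of the last generator in the relation. -/
theorem relP_succ (k : ℕ) : relP (k + 1) = skewEntry genP (k + 1) (k + 1) := by
  rw [relP, skewEntry, Finset.sum_Icc_succ_top (by omega), Finset.mul_sum, Nat.add_sub_cancel]
  have : ∀ j ∈ Finset.Icc 1 k, (-1) ^ j * genP (k + 1 + j) * doubleSeq genP (k + 1 - j) =
      2 * ((-1) ^ j * genP (k + 1 + j) * genP (k + 1 - j)) := fun j hj => by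
    have := (Finset.mem_Icc.mp hj).2
    rw [doubleSeq, if_neg (by omega)]
    ring
  rw [Finset.sum_congr rfl this]
  simp [doubleSeq]
  ring_nf

theorem skewEntry_P (k : ℕ) : skewEntry P (k + 1) (k + 1) = 0 := by
  have h := map_skewEntry (Ideal.Quotient.mk (Ideal.span
    {f : MvPolynomial ℕ ℤ | ∃ k : ℕ, 1 ≤ k ∧ f = relP k})) genP (k + 1) (k + 1)
  rw [← relP_succ] at h
  refine h.symm.trans (Ideal.Quotient.eq_zero_iff_mem.mpr (Ideal.subset_span ?_))
  exact ⟨k + 1, by omega, rfl⟩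

theorem skewEntry_map_P {R : Type*} [CommRing R] (f : Gam →+* R) (k : ℕ) :
    skewEntry (fun i => f (P i)) (k + 1) (k + 1) = 0 := by
  rw [← map_skewEntry, skewEntry_P, map_zero]

theorem map_P_zero {R : Type*} [CommRing R] (f : Gam →+* R) : f (P 0) = 1 := by
  rw [P_zero, map_one]

/-! ### Entries of the multi-Schur Pfaffians as values of the skew form -/

section Entries

variable {R : Type*} [CommRing R] [Algebra Gam R]

/-- The image of `P_k` in a `Γ'`-algebra. -/
abbrev imP (R : Type*) [CommRing R] [Algebra Gam R] (k : ℕ) : R := algebraMap Gam R (P k)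

/-- The vector `∑_a c_a e_{k-a}`. -/
def shiftVec {R : Type*} [CommRing R] (k : ℕ) (c : R⟦X⟧) : ℕ →₀ R :=
  ∑ a ∈ Finset.range (k + 1), Finsupp.single (k - a) (PowerSeries.coeff a c)

theorem coeff_Pplus (k : ℕ) :
    PowerSeries.coeff k (Pplus R) = if k = 0 then 0 else imP R k := by
  simp [Pplus]

theorem half_add_eq_sum (k j : ℕ) (c : R⟦X⟧) (hc : ∀ m, k < m → PowerSeries.coeff m c = 0) :
    half c (k + j) = ∑ a ∈ Finset.range (k + 1), PowerSeries.coeff a c *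
      (if k - a + j = 0 then 0 else imP R (k - a + j)) := by
  rw [half, mul_comm, PowerSeries.coeff_mul, Finset.Nat.sum_antidiagonal_eq_sum_range_succ_mk]
  symm
  refine Finset.sum_subset_zero_on_sdiff (Finset.range_subset_range.mpr (by omega)) ?_ ?_
  · intro a ha
    rw [Finset.mem_sdiff, Finset.mem_range, Finset.mem_range] at ha
    simp only
    rw [hc a (by omega), zero_mul]
  · intro a ha
    rw [Finset.mem_range] at ha
    rw [coeff_Pplus, show k + j - a = k - a + j by omega]

theorem half_eq_sum (k : ℕ) (c : R⟦X⟧) :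
    half c k = ∑ a ∈ Finset.range (k + 1), PowerSeries.coeff a c *
      (if k - a = 0 then 0 else imP R (k - a)) := by
  rw [half, mul_comm, PowerSeries.coeff_mul, Finset.Nat.sum_antidiagonal_eq_sum_range_succ_mk]
  exact Finset.sum_congr rfl fun a _ => by rw [coeff_Pplus]

theorem half_add_coeff_eq_sum (l : ℕ) (c : R⟦X⟧) :
    half c l + PowerSeries.coeff l c =
      ∑ b ∈ Finset.range (l + 1), PowerSeries.coeff b c * imP R (l - b) := by
  rw [half_eq_sum, Finset.sum_range_succ, Finset.sum_range_succ _ l]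
  simp only [Nat.sub_self, if_true, mul_zero, add_zero, show imP R 0 = 1 from map_P_zero _, mul_one]
  congr 1
  refine Finset.sum_congr rfl fun a ha => ?_
  rw [Finset.mem_range] at ha
  rw [if_neg (by omega)]

theorem full_eq_sum (m : ℕ) (c : R⟦X⟧) :
    full c m = ∑ b ∈ Finset.range (m + 1), PowerSeries.coeff b c * doubleSeq (imP R) (m - b) := by
  rw [full_eq, half_eq_sum, Finset.sum_range_succ, Finset.sum_range_succ _ m]
  simp only [Nat.sub_self, if_true, mul_zero, add_zero, doubleSeq, mul_one, Finset.mul_sum]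
  congr 1
  refine Finset.sum_congr rfl fun a ha => ?_
  rw [Finset.mem_range] at ha
  rw [if_neg (by omega), if_neg (by omega)]
  ring

theorem full_sub_eq_sum (l j : ℕ) (hj : j ≤ l) (c : R⟦X⟧) :
    full c (l - j) = ∑ b ∈ Finset.range (l + 1), PowerSeries.coeff b c *
      (if j ≤ l - b then doubleSeq (imP R) (l - b - j) else 0) := by
  rw [full_eq_sum]
  refine Finset.sum_subset_zero_on_sdiff (Finset.range_subset_range.mpr (by omega)) ?_ ?_
  · intro a ha
    rw [Finset.mem_sdiff, Finset.mem_range, Finset.mem_range] at ha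
    rw [if_neg (by omega), mul_zero]
  · intro a ha
    rw [Finset.mem_range] at ha
    rw [if_pos (by omega), show l - j - a = l - a - j by omega]

-- A range of j independent of l lets the sum over j be exchanged with the sums over the terms of
-- the two series in `seqForm_shiftVec`.
omit [Algebra Gam R] in
theorem skewEntry_eq_sum (p : ℕ → R) (k l n : ℕ) (hn : l ≤ n) :
    skewEntry p k l = (if k = 0 then 0 else p k) * p l +
      ∑ j ∈ Finset.Icc 1 n, (-1) ^ j * (if k + j = 0 then 0 else p (k + j)) *
        (if j ≤ l then doubleSeq p (l - j) else 0) := by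
  rw [skewEntry]
  congr 1
  refine Finset.sum_subset_zero_on_sdiff (Finset.Icc_subset_Icc_right hn) ?_ ?_
  · intro j hj
    rw [Finset.mem_sdiff, Finset.mem_Icc, Finset.mem_Icc] at hj
    rw [if_neg (c := j ≤ l) (by omega), mul_zero]
  · intro j hj
    rw [Finset.mem_Icc] at hj
    rw [if_neg (by omega), if_pos hj.2]

theorem seqDual_shiftVec (l : ℕ) (c : R⟦X⟧) :
    seqDual (imP R) (shiftVec l c) = half c l + PowerSeries.coeff l c := by
  simp [half_add_coeff_eq_sum, shiftVec, map_sum]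

/-- Terms of c of degree above k would contribute to `half c (k + j)` but are cut off in `shiftVec k
c`, hence the degree bound. The second series needs none: only its terms up to degree l enter
`entryD`. -/
theorem seqForm_shiftVec (k l : ℕ) (c c' : R⟦X⟧)
    (hc : ∀ m, k < m → PowerSeries.coeff m c = 0) :
    seqForm (imP R) (shiftVec k c) (shiftVec l c') = entryD k l c c' := by
  have hsum : ∀ j ∈ Finset.Icc 1 l, (-1) ^ j * half c (k + j) * full c' (l - j) =
      ∑ a ∈ Finset.range (k + 1), ∑ b ∈ Finset.range (l + 1), PowerSeries.coeff a c *
        PowerSeries.coeff b c' * ((-1) ^ j * (if k - a + j = 0 then 0 else imP R (k - a + j)) *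
        (if j ≤ l - b then doubleSeq (imP R) (l - b - j) else 0)) := fun j hj => by
    rw [half_add_eq_sum k j c hc, full_sub_eq_sum l j (Finset.mem_Icc.mp hj).2, mul_assoc,
      Finset.sum_mul_sum, Finset.mul_sum]
    refine Finset.sum_congr rfl fun a _ => ?_
    rw [Finset.mul_sum]
    exact Finset.sum_congr rfl fun b _ => by ring
  rw [entryD, half_add_coeff_eq_sum, half_eq_sum, Finset.sum_congr rfl hsum, Finset.sum_comm,
    Finset.sum_mul_sum, ← Finset.sum_add_distrib]
  simp only [shiftVec, map_sum, LinearMap.sum_apply]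
  rw [Finset.sum_comm]
  refine Finset.sum_congr rfl fun a _ => ?_
  rw [Finset.sum_comm, ← Finset.sum_add_distrib]
  refine Finset.sum_congr rfl fun b _ => ?_
  rw [seqForm_single, skewEntry_eq_sum _ _ _ l (Nat.sub_le l b), mul_add, Finset.mul_sum]
  congr 1
  ring

theorem seqForm_imP_isAlt : (seqForm (imP R)).IsAlt :=
  seqForm_isAlt (map_P_zero _) (skewEntry_map_P _)

theorem PfD_eq_pfExtForm {r : ℕ} (lam : Fin r → ℕ) (c : Fin r → R⟦X⟧)
    (hc : ∀ i m, lam i < m → PowerSeries.coeff m (c i) = 0) :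
    PfD lam c = pfExtForm (seqForm_imP_isAlt (R := R)) (seqDual (imP R)) r
      (ExteriorAlgebra.ιMulti R r fun i => shiftVec (lam i) (c i)) := by
  rw [← pfaffianExt_eq_pfExtForm, PfD]
  simp only [seqDual_shiftVec, seqForm_shiftVec _ _ _ _ (hc _)]

theorem PfB_eq_PfD {r : ℕ} (lam : Fin r → ℕ) (c : Fin r → R⟦X⟧)
    (hc : ∀ i, PowerSeries.coeff (lam i) (c i) = 0) : PfB lam c = PfD lam c := by
  simp only [PfB, PfD, entryB, entryD, hc, add_zero]

end Entries

/-! ### The basis elements as values on the exterior algebra -/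

section Basis

variable {R S : Type*} [CommRing R] [CommRing S]

theorem map_pfaffian (f : R →+* S) :
    ∀ {n : ℕ} (M : Matrix (Fin n) (Fin n) R), f (pfaffian M) = pfaffian (M.map f)
  | 0, _ => map_one f
  | 1, _ => map_zero f
  | n + 2, M => by
    rw [pfaffian, pfaffian, map_sum]
    refine Finset.sum_congr rfl fun k _ => ?_
    rw [map_mul, map_pfaffian f]
    simp [Matrix.submatrix_map]

theorem map_pfaffianExt (f : R →+* S) :
    ∀ {n : ℕ} (m : Fin n → R) (M : Matrix (Fin n) (Fin n) R),
      f (pfaffianExt m M) = pfaffianExt (fun i => f (m i)) (M.map f)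
  | 0, _, _ => map_one f
  | n + 1, m, M => by
    rw [pfaffianExt, pfaffianExt]
    split_ifs
    · exact map_pfaffian f M
    · rw [map_sum]
      refine Finset.sum_congr rfl fun k _ => ?_
      rw [map_mul, map_pfaffian f]
      simp [Matrix.submatrix_map]

/-- The product in the exterior algebra of the members of a list. -/
def wedge {V : Type*} [AddCommGroup V] [Module R V] (L : List V) : ExteriorAlgebra R V :=
  (L.map (ExteriorAlgebra.ι R)).prod

theorem wedge_nil {V : Type*} [AddCommGroup V] [Module R V] :
    (wedge [] : ExteriorAlgebra R V) = 1 := rfl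

theorem wedge_cons {V : Type*} [AddCommGroup V] [Module R V] (v : V) (L : List V) :
    wedge (v :: L) = ExteriorAlgebra.ι R v * wedge L := by simp [wedge]

theorem ιMulti_eq_wedge {V : Type*} [AddCommGroup V] [Module R V] {n : ℕ} (v : Fin n → V) :
    ExteriorAlgebra.ιMulti R n v = wedge (List.ofFn v) := by
  rw [ExteriorAlgebra.ιMulti_apply, wedge, List.map_ofFn]
  rfl

/-- The basis vector `e_k`. -/
abbrev stdVec (R : Type*) [CommRing R] (k : ℕ) : ℕ →₀ R := Finsupp.single k 1

/-- The alternating form attached to the images of the `P_k` under a homomorphism. -/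
abbrev homForm_isAlt (f : Gam →+* R) : (seqForm fun i => f (P i)).IsAlt :=
  seqForm_isAlt (map_P_zero f) (skewEntry_map_P f)

/-- The linear form on the exterior algebra that gives the extended Pfaffians of size `r` of the
images of the `P_k` under a homomorphism. -/
abbrev homPf (f : Gam →+* R) (r : ℕ) : ExteriorAlgebra R (ℕ →₀ R) →ₗ[R] R :=
  pfExtForm (homForm_isAlt f) (seqDual fun i => f (P i)) r

theorem Pbasis_eq_pfaffianExt (nu : StrictPartition) :
    Pbasis nu = pfaffianExt (fun i => P (nu.parts.get i))
      (Matrix.of fun i j => skewEntry P (nu.parts.get i) (nu.parts.get j)) := by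
  have hpos : ∀ i, nu.parts.get i ≠ 0 := fun i => (nu.pos _ (List.get_mem _ _)).ne'
  have hc : ∀ i, ∀ m, nu.parts.get i ≤ m → PowerSeries.coeff m (1 : Gam⟦X⟧) = 0 := fun i m h => by
    rw [PowerSeries.coeff_one, if_neg]
    have := hpos i
    omega
  have hv : ∀ i, shiftVec (nu.parts.get i) (1 : Gam⟦X⟧) = stdVec Gam (nu.parts.get i) := by
    intro i
    rw [shiftVec, Finset.sum_range_succ']
    simp [PowerSeries.coeff_one]
  rw [Pbasis, PfB_eq_PfD _ _ fun i => hc i _ le_rfl, PfD_eq_pfExtForm _ _ fun i m h => hc i m h.le,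
    ← pfaffianExt_eq_pfExtForm]
  simp only [hv, stdVec, seqForm_single, seqDual, Finsupp.linearCombination_single, one_mul,
    one_smul]
  rfl

theorem map_Pbasis (f : Gam →+* R) (nu : StrictPartition) :
    f (Pbasis nu) = homPf f nu.parts.length (wedge (nu.parts.map (stdVec R))) := by
  have : nu.parts.map (stdVec R) = List.ofFn fun i => stdVec R (nu.parts.get i) := by
    rw [← Function.comp_def, ← List.map_ofFn, List.ofFn_get]
  rw [this, ← ιMulti_eq_wedge, homPf, ← pfaffianExt_eq_pfExtForm, Pbasis_eq_pfaffianExt,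
    map_pfaffianExt]
  congr 1
  · simp
  · ext i j
    simp [seqForm_single, map_skewEntry]

end Basis

/-! ### Expansion of products of vectors in standard products -/

section Expansion

variable {A : Type*} [CommRing A]

/-- The product of the `e_k` for `k` in a list. -/
abbrev stdWedge (A : Type*) [CommRing A] (L : List ℕ) : ExteriorAlgebra A (ℕ →₀ A) :=
  wedge (L.map (stdVec A))

theorem stdWedge_cons (k : ℕ) (L : List ℕ) :
    stdWedge A (k :: L) = ExteriorAlgebra.ι A (stdVec A k) * stdWedge A L := by
  rw [stdWedge, List.map_cons, wedge_cons]

/-- Insertion into a decreasing list: a smaller index passes the head with a sign, an equal one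
gives zero. Recording that all entries come from `k :: L` ensures that the list is still decreasing
when the head is put back. -/
theorem ι_mul_stdWedge_mem (k : ℕ) (L : List ℕ) (hL : L.Pairwise (· > ·)) :
    ExteriorAlgebra.ι A (stdVec A k) * stdWedge A L ∈
      Submodule.span A (stdWedge A '' {L' | L'.Pairwise (· > ·) ∧ L'.length = L.length + 1 ∧
        ∀ x ∈ L', x ∈ k :: L}) := by
  induction L with
  | nil =>
    rw [← stdWedge_cons]
    exact Submodule.subset_span ⟨[k], by simp⟩
  | cons b L ih =>
    rw [List.pairwise_cons] at hL
    rcases lt_trichotomy k b with h | rfl | h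
    · rw [stdWedge_cons, ← mul_assoc, eq_neg_of_add_eq_zero_left
        (ExteriorAlgebra.ι_add_mul_swap (stdVec A k) (stdVec A b)), neg_mul, mul_assoc]
      refine Submodule.neg_mem _ ?_
      refine Submodule.span_induction (p := fun x _ => ExteriorAlgebra.ι A (stdVec A b) * x ∈ _)
        ?_ ?_ ?_ ?_ (ih hL.2)
      · rintro _ ⟨L', ⟨h1, h2, h3⟩, rfl⟩
        refine Submodule.subset_span ⟨b :: L', ⟨?_, by simp [h2], ?_⟩, stdWedge_cons b L'⟩
        · rw [List.pairwise_cons]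
          refine ⟨fun x hx => ?_, h1⟩
          rcases List.mem_cons.mp (h3 x hx) with rfl | hx'
          exacts [h, hL.1 x hx']
        · intro x hx
          rcases List.mem_cons.mp hx with rfl | hx
          · simp
          · rcases List.mem_cons.mp (h3 x hx) with rfl | hx' <;> simp_all
      · simp
      · intro x y _ _ hx hy
        rw [mul_add]
        exact Submodule.add_mem _ hx hy
      · intro a x _ hx
        rw [mul_smul_comm]
        exact Submodule.smul_mem _ a hx
    · rw [stdWedge_cons, ← mul_assoc, ExteriorAlgebra.ι_sq_zero, zero_mul]
      exact Submodule.zero_mem _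
    · rw [← stdWedge_cons]
      refine Submodule.subset_span ⟨k :: b :: L, ⟨?_, by simp, fun x hx => hx⟩, rfl⟩
      rw [List.pairwise_cons, List.pairwise_cons]
      refine ⟨fun x hx => ?_, hL⟩
      rcases List.mem_cons.mp hx with rfl | hx
      exacts [h, (hL.1 x hx).trans h]

theorem wedge_mem_span (L : List (ℕ →₀ A)) :
    wedge L ∈ Submodule.span A ((fun mu : PartitionD => stdWedge A mu.parts) ''
      {mu | mu.length = L.length}) := by
  induction L with
  | nil => exact Submodule.subset_span ⟨⟨[], by simp⟩, rfl, rfl⟩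
  | cons v L ih =>
    rw [wedge_cons]
    refine Submodule.span_induction (p := fun x _ => ExteriorAlgebra.ι A v * x ∈ _)
      ?_ ?_ ?_ ?_ ih
    · rintro _ ⟨mu, hmu, rfl⟩
      induction v using Finsupp.induction_linear with
      | zero => simp
      | add v w hv hw =>
        rw [map_add, add_mul]
        exact Submodule.add_mem _ hv hw
      | single k a =>
        rw [← mul_one a, ← smul_eq_mul, ← Finsupp.smul_single, map_smul, smul_mul_assoc]
        refine Submodule.smul_mem _ a (Submodule.span_mono ?_
          (ι_mul_stdWedge_mem k mu.parts mu.decreasing))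
        rintro _ ⟨L', ⟨h1, h2, -⟩, rfl⟩
        exact ⟨⟨L', h1⟩, h2.trans (congrArg (· + 1) hmu), rfl⟩
    · simp
    · intro x y _ _ hx hy
      rw [mul_add]
      exact Submodule.add_mem _ hx hy
    · intro a x _ hx
      rw [mul_smul_comm]
      exact Submodule.smul_mem _ a hx

theorem exists_wedge_eq_sum (L : List (ℕ →₀ A)) :
    ∃ a : PartitionD →₀ A, (∀ mu ∈ a.support, mu.length = L.length) ∧
      wedge L = a.sum fun mu b => b • stdWedge A mu.parts := by
  obtain ⟨a, ha, h⟩ := (Finsupp.mem_span_image_iff_linearCombination A).mp (wedge_mem_span L)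
  exact ⟨a, fun mu hmu => ha hmu, h.symm⟩

variable {R : Type*} [CommRing R] [Algebra A R]

/-- The homomorphism of exterior algebras, over a homomorphism of base rings, that takes `e_k` to
the given vectors. -/
def extendWedge (A : Type*) [CommRing A] {R : Type*} [CommRing R] [Algebra A R]
    (e : ℕ → ℕ →₀ R) : ExteriorAlgebra A (ℕ →₀ A) →ₐ[A] ExteriorAlgebra R (ℕ →₀ R) :=
  ExteriorAlgebra.lift A ⟨(ExteriorAlgebra.ι R).restrictScalars A ∘ₗ Finsupp.linearCombination A e,
    fun v => by simp⟩

theorem extendWedge_wedge (e : ℕ → ℕ →₀ R) (L : List (ℕ →₀ A)) :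
    extendWedge A e (wedge L) = wedge (L.map (Finsupp.linearCombination A e)) := by
  induction L with
  | nil => simp [wedge_nil]
  | cons v L ih =>
    rw [wedge_cons, map_mul, ih, List.map_cons, wedge_cons]
    congr 1
    simp [extendWedge]

theorem extendWedge_stdWedge (n : ℕ) (L : List ℕ) :
    extendWedge A (fun k => stdVec R (k + n)) (stdWedge A L) = stdWedge R (L.map (· + n)) := by
  rw [extendWedge_wedge, stdWedge, List.map_map, List.map_map]
  congr 2
  funext k
  simp

end Expansion

/-! ### Omission of a last part zero -/

section Drop

variable {R V : Type*} [CommRing R] [AddCommGroup V] [Module R V]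

theorem wedge_append_singleton (L : List V) (v : V) :
    wedge (L ++ [v]) = (-1 : R) ^ L.length • (ExteriorAlgebra.ι R v * wedge L) := by
  induction L with
  | nil => simp [wedge]
  | cons w L ih =>
    rw [List.cons_append, wedge_cons, ih, wedge_cons, mul_smul_comm, ← mul_assoc, ← mul_assoc,
      eq_neg_of_add_eq_zero_left (ExteriorAlgebra.ι_add_mul_swap w v), List.length_cons, pow_succ,
      mul_neg_one, neg_smul, neg_mul, smul_neg]

theorem contr_comm (d d' : Module.Dual R V) (x : ExteriorAlgebra R V) :
    contr d (contr d' x) = -contr d' (contr d x) := CliffordAlgebra.contractLeft_comm ..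

theorem contr_contr (d : Module.Dual R V) (x : ExteriorAlgebra R V) : contr d (contr d x) = 0 :=
  CliffordAlgebra.contractLeft_contractLeft ..

theorem contr_wedge_eq_zero (d : Module.Dual R V) (L : List V) (h : ∀ v ∈ L, d v = 0) :
    contr d (wedge L) = 0 := by
  induction L with
  | nil => exact CliffordAlgebra.contractLeft_one ..
  | cons v L ih =>
    rw [wedge_cons, contr, CliffordAlgebra.contractLeft_ι_mul, h v (by simp), zero_smul,
      show CliffordAlgebra.contractLeft d (wedge L) = 0 from ih fun w hw => h w (by simp [hw]),
      mul_zero, sub_zero]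

/-- On the e_k with k > 0 the form B(e_0, ·) equals -m. For odd length, the expansion along e_0 thus
turns the usual Pfaffian into the extended one, and the signs cancel. For even length, m(e_0) = 1
gives the desired term, and the remaining term contains two contractions by m, which compose to
zero. -/
theorem homPf_append_zero {R : Type*} [CommRing R] (f : Gam →+* R) (L : List ℕ)
    (hL : ∀ k ∈ L, 0 < k) :
    homPf f (L ++ [0]).length (stdWedge R (L ++ [0])) = homPf f L.length (stdWedge R L) := by
  set m := seqDual fun i => f (P i) with hm
  have hd : ∀ k ∈ L.map (stdVec R), (seqForm (fun i => f (P i)) (stdVec R 0) + m) k = 0 := by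
    intro v hv
    obtain ⟨k, hk, rfl⟩ := List.mem_map.mp hv
    obtain ⟨k, rfl⟩ := Nat.exists_eq_succ_of_ne_zero (hL k hk).ne'
    rw [LinearMap.add_apply, seqForm_single, Nat.succ_eq_add_one,
      skewEntry_zero_left (skewEntry_map_P f), hm, Finsupp.linearCombination_single]
    simp
  have hc := contr_wedge_eq_zero _ _ hd
  have hc' : contr (seqForm (fun i => f (P i)) (stdVec R 0)) (stdWedge R L) =
      -contr m (stdWedge R L) := by
    rw [eq_neg_iff_add_eq_zero, ← LinearMap.add_apply, contr, contr, ← map_add]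
    exact hc
  rw [stdWedge, List.map_append, List.map_singleton, wedge_append_singleton, map_smul,
    List.length_map, List.length_append, List.length_singleton, homPf, homPf, pfExtForm, pfExtForm]
  by_cases h : Even L.length
  · rw [if_pos h, if_neg (by simpa [Nat.even_add_one] using h), h.neg_one_pow, one_smul,
      LinearMap.comp_apply, contr, CliffordAlgebra.contractLeft_ι_mul, map_sub, map_smul]
    have h0 : pfForm (homForm_isAlt f) (ExteriorAlgebra.ι R (stdVec R 0) *
        contr m (stdWedge R L)) = 0 := by
      rw [pfForm_ι_mul, contr_comm, hc', map_neg, map_neg, contr_contr, neg_zero, map_zero,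
        neg_zero]
    refine (congrArg₂ _ ?_ h0).trans (sub_zero _)
    simp [P_zero]
  · rw [if_neg h, if_pos (by simpa [Nat.even_add_one] using h),
      (Nat.not_even_iff_odd.mp h).neg_one_pow, pfForm_ι_mul, LinearMap.comp_apply, hc', map_neg]
    simp [hm]

theorem eq_filter_append_zero (L : List ℕ) (hL : L.Pairwise (· > ·)) (h0 : 0 ∈ L) :
    L = L.filter (fun a => 0 < a) ++ [0] := by
  induction L with
  | nil => simp at h0
  | cons b L ih =>
    rw [List.pairwise_cons] at hL
    by_cases h : 0 ∈ L
    · have : 0 < b := hL.1 0 h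
      rw [List.filter_cons_of_pos (by simpa using this), List.cons_append, ← ih hL.2 h]
    · obtain rfl : 0 = b := by simpa [h] using h0
      have : L = [] := List.eq_nil_iff_forall_not_mem.mpr fun x hx => by
        have := hL.1 x hx
        omega
      simp [this]

theorem homPf_stdWedge {R : Type*} [CommRing R] (f : Gam →+* R) (mu : PartitionD) :
    homPf f mu.length (stdWedge R mu.parts) = f (Pbasis mu.strict) := by
  rw [map_Pbasis, PartitionD.length, PartitionD.strict]
  by_cases h : 0 ∈ mu.parts
  · have := eq_filter_append_zero mu.parts mu.decreasing h
    conv_lhs => rw [this]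
    exact homPf_append_zero f _ fun k hk => by simpa using (List.mem_filter.mp hk).2
  · have : mu.parts.filter (fun a => 0 < a) = mu.parts := List.filter_eq_self.mpr fun a ha => by
      simpa using Nat.pos_of_ne_zero fun h0 => h (h0 ▸ ha)
    simp only [this]

end Drop

/-! ### Existence of the expansions -/

section Existence

variable {A R : Type*} [CommRing A] [CommRing R] [Algebra A R]

/-- As c has degree at most k, enlarging k brings in no further terms and only shifts the indices.
-/
theorem shiftVec_map (k n : ℕ) (c : A⟦X⟧) (hc : ∀ m, k < m → PowerSeries.coeff m c = 0) :
    shiftVec (k + n) (PowerSeries.map (algebraMap A R) c) =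
      Finsupp.linearCombination A (fun i => stdVec R (i + n)) (shiftVec k c) := by
  simp only [shiftVec, map_sum, Finsupp.linearCombination_single]
  symm
  refine Finset.sum_subset_zero_on_sdiff (Finset.range_subset_range.mpr (by omega)) ?_ ?_
  · intro a ha
    rw [Finset.mem_sdiff, Finset.mem_range, Finset.mem_range] at ha
    rw [PowerSeries.coeff_map, hc a (by omega), map_zero, Finsupp.single_zero]
  · intro a ha
    rw [Finset.mem_range] at ha
    rw [PowerSeries.coeff_map, show k + n - a = k - a + n by omega, stdVec, Finsupp.smul_single,
      Algebra.algebraMap_eq_smul_one]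

variable [Algebra Gam R]

/-- The cases n = 0 and n = 1 serve types D and B, so that one expansion over A yields both. -/
theorem PfD_eq_sum {r : ℕ} (lam : Fin r → ℕ) (c : Fin r → A⟦X⟧)
    (hc : ∀ i m, lam i < m → PowerSeries.coeff m (c i) = 0) (a : PartitionD →₀ A)
    (h : wedge (List.ofFn fun i => shiftVec (lam i) (c i)) =
      a.sum fun mu b => b • stdWedge A mu.parts) (n : ℕ) :
    PfD (fun i => lam i + n) (fun i => PowerSeries.map (algebraMap A R) (c i)) =
      a.sum fun mu b => algebraMap A R b *
        homPf (algebraMap Gam R) r (stdWedge R (mu.parts.map (· + n))) := by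
  have hc' : ∀ i m, lam i + n < m →
      PowerSeries.coeff m (PowerSeries.map (algebraMap A R) (c i)) = 0 := fun i m hm => by
    rw [PowerSeries.coeff_map, hc i m (by omega), map_zero]
  rw [PfD_eq_pfExtForm _ _ hc']
  simp only [fun i => shiftVec_map (R := R) (lam i) n (c i) (hc i)]
  have : (List.ofFn fun i => Finsupp.linearCombination A (fun i => stdVec R (i + n))
      (shiftVec (lam i) (c i))) = (List.ofFn fun i => shiftVec (lam i) (c i)).map
      (Finsupp.linearCombination A (fun i => stdVec R (i + n))) := by
    rw [List.map_ofFn]; rfl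
  rw [ιMulti_eq_wedge, this, ← extendWedge_wedge, h, Finsupp.sum, Finsupp.sum, map_sum, map_sum]
  refine Finset.sum_congr rfl fun mu _ => ?_
  rw [map_smul, extendWedge_stdWedge, LinearMap.map_smul_of_tower, Algebra.smul_def]

end Existence

theorem PartitionD.plus_injective : Function.Injective PartitionD.plus := by
  intro mu nu h
  have := congrArg StrictPartition.parts h
  exact PartitionD.ext (List.map_injective_iff.mpr (add_left_injective 1) this)

/-- The parity of the length decides whether a part 0 has been dropped. -/
theorem PartitionD.strict_injOn (r : ℕ) :
    Set.InjOn PartitionD.strict {mu | mu.length ≡ r [MOD 2]} := by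
  have hcases : ∀ mu : PartitionD, mu.parts = mu.strict.parts ∨
      mu.parts = mu.strict.parts ++ [0] := by
    intro mu
    by_cases h : 0 ∈ mu.parts
    · exact Or.inr (eq_filter_append_zero mu.parts mu.decreasing h)
    · exact Or.inl (List.filter_eq_self.mpr fun a ha => by
        simpa using Nat.pos_of_ne_zero fun h0 => h (h0 ▸ ha)).symm
  intro mu hmu nu hnu h
  have hpar : mu.parts.length ≡ nu.parts.length [MOD 2] := hmu.trans hnu.symm
  apply PartitionD.ext
  rcases hcases mu with h1 | h1 <;> rcases hcases nu with h2 | h2 <;> rw [h] at h1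
  · rw [h1, h2]
  · rw [h1, h2, List.length_append, List.length_singleton, Nat.ModEq] at hpar
    omega
  · rw [h1, h2, List.length_append, List.length_singleton, Nat.ModEq] at hpar
    omega
  · rw [h1, h2]

theorem exists_expansions {σ : Type} {n : ℕ} (lam : Fin n → ℕ)
    (c : Fin n → (MvPolynomial σ ℤ)⟦X⟧) (hc : ∀ i m, lam i < m → PowerSeries.coeff m (c i) = 0) :
    ∃ p r : StrictPartition →₀ MvPolynomial σ ℤ,
      IsExpansion (PfB (fun i => lam i + 1)
        fun i => PowerSeries.map (MvPolynomial.map (Int.castRingHom Gam)) (c i)) p ∧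
      IsExpansion (PfD lam
        fun i => PowerSeries.map (MvPolynomial.map (Int.castRingHom Gam)) (c i)) r ∧
      ∀ mu : PartitionD, mu.length ≡ n [MOD 2] → r mu.strict = p mu.plus := by
  let _ : Algebra (MvPolynomial σ ℤ) (MvPolynomial σ Gam) :=
    (MvPolynomial.map (Int.castRingHom Gam)).toAlgebra
  obtain ⟨a, ha, h⟩ := exists_wedge_eq_sum (List.ofFn fun i => shiftVec (lam i) (c i))
  rw [List.length_ofFn] at ha
  have hsum := PfD_eq_sum (R := MvPolynomial σ Gam) lam c hc a h
  refine ⟨a.mapDomain PartitionD.plus, a.mapDomain PartitionD.strict, ?_, ?_, fun mu hmu => ?_⟩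
  -- The raised index exceeds the degree of c_i, so the type B Pfaffian is a type D one.
  · have hc1 : ∀ i, PowerSeries.coeff (lam i + 1)
        (PowerSeries.map (MvPolynomial.map (Int.castRingHom Gam)) (c i)) = 0 := fun i => by
      rw [PowerSeries.coeff_map, hc i _ (Nat.lt_succ_self _), map_zero]
    rw [IsExpansion, PfB_eq_PfD _ _ hc1, Finsupp.sum_mapDomain_index (by simp)
      (by intros; rw [map_add, add_mul])]
    refine (hsum 1).trans (Finsupp.sum_congr fun mu hmu => ?_)
    have := map_Pbasis (R := MvPolynomial σ Gam) (algebraMap Gam (MvPolynomial σ Gam)) mu.plus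
    rw [show mu.plus.parts.length = n from (List.length_map ..).trans (ha mu hmu)] at this
    exact congrArg _ this.symm
  · rw [IsExpansion, Finsupp.sum_mapDomain_index (by simp) (by intros; rw [map_add, add_mul])]
    refine (hsum 0).trans (Finsupp.sum_congr fun mu hmu => ?_)
    have := homPf_stdWedge (R := MvPolynomial σ Gam) (algebraMap Gam (MvPolynomial σ Gam)) mu
    rw [ha mu hmu] at this
    simp only [add_zero, List.map_id']
    exact congrArg _ this
  -- Both coefficients equal `a mu`: each push-forward is along a map that is injective on the
  -- partitions concerned. For lengths other than n this value is zero.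
  · rw [Finsupp.mapDomain_apply PartitionD.plus_injective]
    refine Finsupp.mapDomain_apply' {mu : PartitionD | mu.length ≡ n [MOD 2]} a (fun nu hnu => ?_)
      (PartitionD.strict_injOn n) hmu
    rw [Set.mem_ofPred_eq, ha nu hnu]

/-! ### Adjunction of one variable -/

section Adjoin

variable {R : Type*} [CommRing R]

/-- The homomorphism from `Γ'` that takes the given values on the `P_k`. -/
def liftGam (p : ℕ → R) (hp0 : p 0 = 1) (hp : ∀ k, skewEntry p (k + 1) (k + 1) = 0) : Gam →+* R :=
  Ideal.Quotient.lift _ (MvPolynomial.eval₂Hom (Int.castRingHom R) fun i => p (i + 1)) (by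
    have h : (fun i => MvPolynomial.eval₂Hom (Int.castRingHom R) (fun i => p (i + 1)) (genP i)) =
        p := by
      funext i
      cases i <;> simp [genP, hp0]
    intro x hx
    rw [← RingHom.mem_ker]
    refine (Ideal.span_le.mpr ?_) hx
    rintro _ ⟨k, hk, rfl⟩
    obtain ⟨k, rfl⟩ := Nat.exists_eq_add_of_le' hk
    rw [SetLike.mem_coe, RingHom.mem_ker, relP_succ, map_skewEntry, h, hp])

theorem liftGam_P (p : ℕ → R) (hp0 : p 0 = 1) (hp : ∀ k, skewEntry p (k + 1) (k + 1) = 0) (k : ℕ) :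
    liftGam p hp0 hp (P k) = p k := by
  rw [liftGam, P, Ideal.Quotient.lift_mk]
  cases k <;> simp [genP, hp0]

/-- The coefficients `1, 2u, 2u², …` of `(1 + u z) / (1 - u z)`. -/
def geomCoeff (u : R) (a : ℕ) : R := if a = 0 then 1 else 2 * u ^ a

theorem geomCoeff_succ (u : R) (a : ℕ) : geomCoeff u (a + 1) = 2 * u ^ (a + 1) := by
  simp [geomCoeff]

/-- The truncated convolution of a sequence with `1, 2u, 2u², …`. -/
def geomConv (u : R) (g : ℕ → R) (k : ℕ) : R :=
  ∑ a ∈ Finset.range k, geomCoeff u a * g (k - a)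

theorem geomConv_succ (u : R) (g : ℕ → R) (k : ℕ) :
    geomConv u g (k + 1) = geomConv u (fun i => g (i + 1)) k + geomCoeff u k * g 1 := by
  rw [geomConv, Finset.sum_range_succ, geomConv, Nat.add_sub_cancel_left]
  congr 1
  refine Finset.sum_congr rfl fun a ha => ?_
  rw [Finset.mem_range] at ha
  rw [show k + 1 - a = k - a + 1 by omega]

theorem geomConv_congr (u : R) {g h : ℕ → R} (H : ∀ i, g (i + 1) = h (i + 1)) (k : ℕ) :
    geomConv u g k = geomConv u h k := by
  refine Finset.sum_congr rfl fun a ha => ?_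
  rw [Finset.mem_range] at ha
  rw [show k - a = k - a - 1 + 1 by omega, H]

theorem geomConv_add (u : R) (g h : ℕ → R) (k : ℕ) :
    geomConv u (fun i => g i + h i) k = geomConv u g k + geomConv u h k := by
  simp [geomConv, mul_add, Finset.sum_add_distrib]

theorem geomConv_sub (u : R) (g h : ℕ → R) (k : ℕ) :
    geomConv u (fun i => g i - h i) k = geomConv u g k - geomConv u h k := by
  simp [geomConv, mul_sub, Finset.sum_sub_distrib]

theorem geomConv_mul_const (u : R) (g : ℕ → R) (c : R) (k : ℕ) :
    geomConv u (fun i => g i * c) k = geomConv u g k * c := by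
  simp [geomConv, Finset.sum_mul, mul_assoc]

theorem geomConv_const_mul (u : R) (g : ℕ → R) (c : R) (k : ℕ) :
    geomConv u (fun i => c * g i) k = c * geomConv u g k := by
  simp [geomConv, Finset.mul_sum, mul_left_comm]

/-- The vector `e_k + 2u e_{k-1} + ⋯ + 2u^{k-l-1} e_{l+1} + u^{k-l} e_l`. -/
def stepVec (u : R) (k l : ℕ) : ℕ →₀ R :=
  ∑ a ∈ Finset.range (k - l), Finsupp.single (k - a) (geomCoeff u a) +
    Finsupp.single l (u ^ (k - l))

/-- Below index l + 1 the two tails cancel, and at l + 1 the coefficient drops from 2u^{d+1} to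
u^{d+1}. The subtracted index has to be positive, since the coefficient at e_0 carries no factor 2.
-/
theorem stepVec_sub (u : R) (l d : ℕ) :
    stepVec u (l + 1 + (d + 1)) (l + 1) =
      stepVec u (l + 1 + (d + 1)) 0 - u ^ (d + 1) • stepVec u (l + 1) 0 := by
  simp only [stepVec, Nat.sub_zero, Nat.add_sub_cancel_left]
  rw [add_comm (l + 1) (d + 1), Finset.sum_range_add _ (d + 1) (l + 1), Finset.sum_range_succ' _ l,
    Finset.sum_range_succ' _ l, smul_add, smul_add, Finset.smul_sum]
  have : ∀ x ∈ Finset.range l, Finsupp.single (d + 1 + (l + 1) - (d + 1 + (x + 1)))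
      (geomCoeff u (d + 1 + (x + 1))) =
      u ^ (d + 1) • Finsupp.single (l + 1 - (x + 1)) (geomCoeff u (x + 1)) := fun x _ => by
    rw [← add_assoc (d + 1) x 1, geomCoeff_succ, geomCoeff_succ, Finsupp.smul_single, smul_eq_mul,
      show d + 1 + (l + 1) - (d + 1 + x + 1) = l + 1 - (x + 1) by omega]
    congr 1
    ring
  have h2 : Finsupp.single (l + 1) (2 * u ^ (d + 1)) =
      Finsupp.single (l + 1) (u ^ (d + 1)) + Finsupp.single (l + 1) (u ^ (d + 1)) := by
    rw [← Finsupp.single_add, two_mul]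
  rw [Finset.sum_congr rfl this, add_zero, geomCoeff_succ, Nat.add_sub_cancel_left, h2]
  simp only [geomCoeff, if_true, Finsupp.smul_single, smul_eq_mul, mul_one, Nat.sub_zero, pow_add]
  abel

variable {p : ℕ → R} (hp : ∀ k, skewEntry p (k + 1) (k + 1) = 0) (u : R)

/-- The sequence obtained from `p` by adjunction of the variable `u`. -/
def adjoinSeq (p : ℕ → R) (u : R) (k : ℕ) : R := geomConv u p k + u ^ k

theorem seqDual_stepVec (p : ℕ → R) (hp0 : p 0 = 1) (u : R) (k : ℕ) :
    seqDual p (stepVec u k 0) = adjoinSeq p u k := by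
  simp [stepVec, adjoinSeq, geomConv, hp0, map_sum]

include hp

theorem seqForm_stepVec (hp0 : p 0 = 1) (k l : ℕ) :
    seqForm p (stepVec u k 0) (stepVec u l 0) =
      geomConv u (fun i => geomConv u (fun j => skewEntry p i j) l) k +
        u ^ l * geomConv u p k - u ^ k * geomConv u p l := by
  have h1 : geomConv u p k = geomConv u (fun i => skewEntry p i 0) k :=
    geomConv_congr u (fun i => (skewEntry_zero_right p hp0 i).symm) k
  have h2 : geomConv u p l = -geomConv u (fun i => skewEntry p 0 i) l := by
    rw [← neg_one_mul, ← geomConv_const_mul]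
    exact geomConv_congr u (fun i => by rw [skewEntry_zero_left hp]; ring) l
  rw [h1, h2, mul_neg, sub_neg_eq_add]
  simp only [stepVec, Nat.sub_zero, map_add, map_sum, LinearMap.add_apply, LinearMap.sum_apply,
    seqForm_single, geomConv, Finset.mul_sum, Finset.sum_add_distrib]
  rw [Finset.sum_comm, skewEntry_self hp, add_right_comm]
  simp only [mul_zero, add_zero]
  refine congrArg₂ (· + ·) (congrArg₂ (· + ·) ?_ ?_) ?_
  · refine Finset.sum_congr rfl fun _ _ => Finset.sum_congr rfl fun _ _ => by ring
  · refine Finset.sum_congr rfl fun _ _ => by ring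
  · refine Finset.sum_congr rfl fun _ _ => by ring

theorem seqForm_stepVec_one (hp0 : p 0 = 1) (k : ℕ) :
    seqForm p (stepVec u (k + 1) 0) (stepVec u 1 0) =
      adjoinSeq p u (k + 1) * adjoinSeq p u 1 - adjoinSeq p u (k + 2) := by
  have h : geomConv u (fun i => geomConv u (fun j => skewEntry p i j) 1) (k + 1) =
      geomConv u (fun i => p i * p 1 - p (i + 1)) (k + 1) :=
    geomConv_congr u (fun i => by simp [geomConv, geomCoeff, skewEntry_one]) _
  have h1 : geomConv u p 1 = p 1 := by simp [geomConv, geomCoeff]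
  rw [seqForm_stepVec hp u hp0, h, geomConv_sub, geomConv_mul_const]
  simp only [adjoinSeq, h1, geomConv_succ u p (k + 1), geomCoeff_succ]
  ring

theorem seqForm_stepVec_add (hp0 : p 0 = 1) (k l : ℕ) :
    seqForm p (stepVec u (k + 1) 0) (stepVec u (l + 2) 0) +
      seqForm p (stepVec u (k + 2) 0) (stepVec u (l + 1) 0) =
      adjoinSeq p u (k + 1) * adjoinSeq p u (l + 2) -
        adjoinSeq p u (k + 2) * adjoinSeq p u (l + 1) := by
  have hone : ∀ j, skewEntry p 1 (j + 1) = p (j + 2) - p (j + 1) * p 1 := fun j => by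
    rw [skewEntry_skew hp hp0, skewEntry_one]; ring
  set S := geomConv u (fun i => geomConv u (fun j => skewEntry p i (j + 1)) (l + 1)) (k + 1) with hS
  set S' := geomConv u (fun i => geomConv u (fun j => skewEntry p (i + 1) j) (l + 1)) (k + 1)
    with hS'
  have e1 : geomConv u (fun i => geomConv u (fun j => skewEntry p i j) (l + 2)) (k + 1) =
      S + geomCoeff u (l + 1) *
        (geomConv u p (k + 1) * p 1 - geomConv u (fun i => p (i + 1)) (k + 1)) := by
    simp only [geomConv_succ u _ (l + 1)]
    rw [geomConv_add, geomConv_const_mul, ← geomConv_mul_const, ← geomConv_sub]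
    congr 2
    exact geomConv_congr u (fun i => skewEntry_one p i) _
  have e2 : geomConv u (fun i => geomConv u (fun j => skewEntry p i j) (l + 1)) (k + 2) =
      S' + geomCoeff u (k + 1) *
        (geomConv u (fun i => p (i + 1)) (l + 1) - geomConv u p (l + 1) * p 1) := by
    rw [geomConv_succ u _ (k + 1), ← geomConv_mul_const, ← geomConv_sub]
    congr 2
    exact geomConv_congr u (fun i => hone i) _
  have e3 : S + S' = geomConv u p (k + 1) * geomConv u (fun i => p (i + 1)) (l + 1) -
      geomConv u (fun i => p (i + 1)) (k + 1) * geomConv u p (l + 1) := by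
    rw [hS, hS', ← geomConv_add, ← geomConv_mul_const, ← geomConv_mul_const, ← geomConv_sub]
    refine geomConv_congr u (fun i => ?_) _
    rw [← geomConv_add, ← geomConv_const_mul, ← geomConv_const_mul, ← geomConv_sub]
    exact geomConv_congr u (fun j => skewEntry_add p i j) _
  rw [seqForm_stepVec hp u hp0, seqForm_stepVec hp u hp0, e1, e2]
  simp only [adjoinSeq, geomConv_succ u p (k + 1), geomConv_succ u p (l + 1), geomCoeff_succ]
  linear_combination e3

/-- Both sides have the same recurrence and the same values at second index 1. As the right side is
alternating, the new sequence satisfies the relations of Γ', without any division by 2. -/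
theorem skewEntry_adjoinSeq (hp0 : p 0 = 1) (l : ℕ) : ∀ k,
    skewEntry (adjoinSeq p u) (k + 1) (l + 1) =
      seqForm p (stepVec u (k + 1) 0) (stepVec u (l + 1) 0) := by
  induction l with
  | zero => intro k; rw [seqForm_stepVec_one hp u hp0, skewEntry_one]
  | succ l ih =>
    intro k
    linear_combination skewEntry_add (adjoinSeq p u) k l - seqForm_stepVec_add hp u hp0 k l -
      ih (k + 1)

theorem skewEntry_adjoinSeq_self (hp0 : p 0 = 1) (k : ℕ) :
    skewEntry (adjoinSeq p u) (k + 1) (k + 1) = 0 := by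
  rw [skewEntry_adjoinSeq hp u hp0]
  exact seqForm_isAlt hp0 hp _

end Adjoin

/-! ### Linear independence of the basis elements -/

section Independence

variable {S : Type*} [CommRing S]

/-- The composite `Γ' → S → S[u]`. -/
abbrev polyHom (f : Gam →+* S) : Gam →+* S[X] := Polynomial.C.comp f

/-- The homomorphism `Γ' → S[u]` that takes `Q(z)` to the product of its image under a given
homomorphism and `(1 + u z) / (1 - u z)`. -/
def adjoinHom (f : Gam →+* S) : Gam →+* S[X] :=
  liftGam (adjoinSeq (fun i => polyHom f (P i)) Polynomial.X) (by simp [adjoinSeq, geomConv])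
    (skewEntry_adjoinSeq_self (skewEntry_map_P (polyHom f)) _ (map_P_zero (polyHom f)))

theorem adjoinHom_P (f : Gam →+* S) (k : ℕ) :
    adjoinHom f (P k) = adjoinSeq (fun i => polyHom f (P i)) Polynomial.X k :=
  liftGam_P ..

theorem adjoinHom_Pbasis (f : Gam →+* S) (nu : StrictPartition) :
    adjoinHom f (Pbasis nu) = homPf (polyHom f) nu.parts.length
      (wedge (nu.parts.map fun k => stepVec (Polynomial.X : S[X]) k 0)) := by
  have : nu.parts.map (fun k => stepVec (Polynomial.X : S[X]) k 0) =
      List.ofFn fun i => stepVec (Polynomial.X : S[X]) (nu.parts.get i) 0 := by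
    conv_lhs => rw [← List.ofFn_get nu.parts]
    rw [List.map_ofFn]
    rfl
  rw [this, ← ιMulti_eq_wedge, homPf, ← pfaffianExt_eq_pfExtForm, Pbasis_eq_pfaffianExt,
    map_pfaffianExt]
  congr 1
  · funext i
    rw [adjoinHom_P, seqDual_stepVec _ (map_P_zero (polyHom f))]
  · ext1 i j
    obtain ⟨k, hk⟩ := Nat.exists_eq_succ_of_ne_zero (nu.pos _ (List.get_mem nu.parts i)).ne'
    obtain ⟨l, hl⟩ := Nat.exists_eq_succ_of_ne_zero (nu.pos _ (List.get_mem nu.parts j)).ne'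
    rw [Matrix.map_apply, Matrix.of_apply, Matrix.of_apply, map_skewEntry, hk, hl]
    simp only [adjoinHom_P]
    exact skewEntry_adjoinSeq (skewEntry_map_P (polyHom f)) _ (map_P_zero (polyHom f)) l k

/-- The vectors obtained from those of a decreasing sequence by subtracting from each a multiple of
the next. -/
def stepVecs (u : S) : ℕ → List ℕ → List (ℕ →₀ S)
  | k, [] => [stepVec u k 0]
  | k, l :: L => stepVec u k l :: stepVecs u l L

/-- Before the subtractions each factor involves u up to the power of its own index; afterwards the
top exponents are the differences of consecutive indices and telescope to k. -/
theorem wedge_stepVecs (u : S) (k : ℕ) (L : List ℕ) (hL : (k :: L).Pairwise (· > ·))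
    (hpos : ∀ l ∈ L, 0 < l) :
    wedge (R := S) ((k :: L).map fun k => stepVec u k 0) = wedge (stepVecs u k L) := by
  induction L generalizing k with
  | nil => rfl
  | cons l L ih =>
    rw [List.pairwise_cons] at hL
    obtain ⟨l, rfl⟩ : ∃ l', l = l' + 1 := ⟨l - 1, by have := hpos l (by simp); omega⟩
    obtain ⟨d, rfl⟩ : ∃ d, k = l + 1 + (d + 1) :=
      ⟨k - (l + 2), by have : l + 1 < k := hL.1 (l + 1) (by simp); omega⟩
    have h : wedge (R := S) (stepVecs u (l + 1) L) =
        ExteriorAlgebra.ι S (stepVec u (l + 1) 0) * wedge (L.map fun k => stepVec u k 0) := by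
      rw [← ih (l + 1) hL.2 fun x hx => hpos x (by simp [hx]), List.map_cons, wedge_cons]
    rw [stepVecs, wedge_cons, stepVec_sub, map_sub, map_smul, sub_mul, List.map_cons, wedge_cons,
      ih (l + 1) hL.2 fun x hx => hpos x (by simp [hx])]
    rw [smul_mul_assoc, h, ← mul_assoc (ExteriorAlgebra.ι S (stepVec u (l + 1) 0)),
      ExteriorAlgebra.ι_sq_zero, zero_mul, smul_zero, sub_zero]

/-- Sums of products of `n` standard vectors with powers `u^i`, `i < d`, as coefficients. -/
def lowDegree (S : Type*) [CommRing S] (d n : ℕ) : AddSubgroup (ExteriorAlgebra S[X] (ℕ →₀ S[X])) :=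
  -- Only an additive subgroup: multiplication by u would violate the bound on the exponents.
  AddSubgroup.closure {x | ∃ i L, i < d ∧ L.length = n ∧
    x = (Polynomial.X : S[X]) ^ i • stdWedge S[X] L}

theorem lowDegree_mono {d d' : ℕ} (h : d ≤ d') (n : ℕ) : lowDegree S d n ≤ lowDegree S d' n :=
  AddSubgroup.closure_mono fun _ ⟨i, L, hi, hL, hx⟩ => ⟨i, L, hi.trans_le h, hL, hx⟩

theorem ι_single_pow (i j : ℕ) : ExteriorAlgebra.ι S[X] (Finsupp.single j ((Polynomial.X : S[X]) ^ i)) =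
    (Polynomial.X : S[X]) ^ i • ExteriorAlgebra.ι S[X] (stdVec S[X] j) := by
  rw [← map_smul, stdVec, Finsupp.smul_single, smul_eq_mul, mul_one]

theorem ι_single_mul_mem_lowDegree (i j : ℕ) {d n : ℕ} {x : ExteriorAlgebra S[X] (ℕ →₀ S[X])}
    (hx : x ∈ lowDegree S d n) :
    ExteriorAlgebra.ι S[X] (Finsupp.single j ((Polynomial.X : S[X]) ^ i)) * x ∈
      lowDegree S (i + d) (n + 1) := by
  rw [ι_single_pow]
  induction hx using AddSubgroup.closure_induction with
  | mem x hx =>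
    obtain ⟨i', L, hi, hL, rfl⟩ := hx
    refine AddSubgroup.subset_closure ⟨i + i', j :: L, by omega, by simp [hL], ?_⟩
    rw [stdWedge_cons, smul_mul_smul_comm, pow_add]
  | zero => rw [mul_zero]; exact zero_mem _
  | add x y _ _ hx hy => rw [mul_add]; exact add_mem hx hy
  | neg x _ hx => rw [mul_neg]; exact neg_mem hx

theorem ι_single_geomCoeff_mul_mem_lowDegree (i j : ℕ) {d n : ℕ}
    {x : ExteriorAlgebra S[X] (ℕ →₀ S[X])} (hx : x ∈ lowDegree S d n) :
    ExteriorAlgebra.ι S[X] (Finsupp.single j (geomCoeff (Polynomial.X : S[X]) i)) * x ∈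
      lowDegree S (i + d) (n + 1) := by
  have := ι_single_mul_mem_lowDegree i j hx
  rw [geomCoeff]
  split_ifs with h
  · subst h
    simpa using this
  · rw [two_mul, Finsupp.single_add, map_add, add_mul]
    exact add_mem this this

theorem ι_stepVec_mul (k l : ℕ) (x : ExteriorAlgebra S[X] (ℕ →₀ S[X])) :
    ExteriorAlgebra.ι S[X] (stepVec (Polynomial.X : S[X]) k l) * x =
      ∑ a ∈ Finset.range (k - l),
        ExteriorAlgebra.ι S[X] (Finsupp.single (k - a) (geomCoeff (Polynomial.X : S[X]) a)) * x +
      ExteriorAlgebra.ι S[X] (Finsupp.single l ((Polynomial.X : S[X]) ^ (k - l))) * x := by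
  rw [stepVec, map_add, map_sum, add_mul, Finset.sum_mul]

theorem sum_ι_geomCoeff_mul_mem_lowDegree {k l : ℕ} (hl : l ≤ k) {n : ℕ}
    {x : ExteriorAlgebra S[X] (ℕ →₀ S[X])} (hx : x ∈ lowDegree S (l + 1) n) :
    ∑ a ∈ Finset.range (k - l),
        ExteriorAlgebra.ι S[X] (Finsupp.single (k - a) (geomCoeff (Polynomial.X : S[X]) a)) * x ∈
      lowDegree S k (n + 1) := by
  refine AddSubgroup.sum_mem _ fun a ha => ?_
  have ha := Finset.mem_range.mp ha
  have h : a + (l + 1) ≤ k := by omega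
  exact lowDegree_mono h _ (ι_single_geomCoeff_mul_mem_lowDegree a _ hx)

/-- Only the last term of each factor attains its top exponent. Choosing it in every factor gives
u^k times the product over the later indices followed by 0. -/
theorem wedge_stepVecs_sub_mem (k : ℕ) (L : List ℕ) (hL : (k :: L).Pairwise (· > ·)) :
    wedge (R := S[X]) (stepVecs (Polynomial.X : S[X]) k L) -
      (Polynomial.X : S[X]) ^ k • stdWedge S[X] (L ++ [0]) ∈ lowDegree S k (L.length + 1) := by
  induction L generalizing k with
  | nil =>
    have h1 : (1 : ExteriorAlgebra S[X] (ℕ →₀ S[X])) ∈ lowDegree S (0 + 1) 0 :=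
      AddSubgroup.subset_closure ⟨0, [], by simp, rfl, by simp [wedge]⟩
    have h2 := sum_ι_geomCoeff_mul_mem_lowDegree (Nat.zero_le k) h1
    rw [stepVecs, wedge_cons, wedge_nil, ι_stepVec_mul, ι_single_pow, List.nil_append,
      stdWedge_cons, smul_mul_assoc, Nat.sub_zero]
    have h3 : stdWedge S[X] [] = 1 := wedge_nil
    rw [h3, add_sub_cancel_right]
    exact h2
  | cons l L ih =>
    rw [List.pairwise_cons] at hL
    have hlk : l < k := hL.1 l (by simp)
    have ih := ih l hL.2
    rw [stepVecs, wedge_cons]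
    generalize wedge (R := S[X]) (stepVecs (Polynomial.X : S[X]) l L) = W at ih ⊢
    have hW : W ∈ lowDegree S (l + 1) (L.length + 1) := by
      rw [← sub_add_cancel W ((Polynomial.X : S[X]) ^ l • stdWedge S[X] (L ++ [0]))]
      exact add_mem (lowDegree_mono (Nat.le_succ l) _ ih)
        (AddSubgroup.subset_closure ⟨l, _, Nat.lt_succ_self l, by simp, rfl⟩)
    have h1 := sum_ι_geomCoeff_mul_mem_lowDegree hlk.le hW
    have h2 := ι_single_mul_mem_lowDegree (k - l) l ih
    rw [Nat.sub_add_cancel hlk.le, mul_sub, ι_single_pow, smul_mul_smul_comm, ← pow_add,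
      Nat.sub_add_cancel hlk.le, ← stdWedge_cons] at h2
    rw [ι_stepVec_mul, ι_single_pow, List.cons_append, add_sub_assoc]
    exact AddSubgroup.add_mem _ h1 h2

/-- The form itself is free of u, so the degree in u of a value is governed by the coefficients of
the standard products alone. -/
theorem homPf_polyHom_stdWedge (f : Gam →+* S) (L : List ℕ) : ∃ b : S,
    homPf (polyHom f) L.length (stdWedge S[X] L) = Polynomial.C b := by
  have : L.map (stdVec S[X]) = List.ofFn fun i => stdVec S[X] (L.get i) := by
    rw [← Function.comp_def, ← List.map_ofFn, List.ofFn_get]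
  refine ⟨f (pfaffianExt (fun i => P (L.get i))
    (Matrix.of fun i j => skewEntry P (L.get i) (L.get j))), ?_⟩
  rw [stdWedge, this, ← ιMulti_eq_wedge, homPf, ← pfaffianExt_eq_pfExtForm, ← RingHom.comp_apply,
    map_pfaffianExt]
  congr 1
  · simp
  · ext1 i j
    simp [seqForm_single, map_skewEntry]

theorem coeff_homPf_of_mem_lowDegree (f : Gam →+* S) {d n : ℕ}
    {x : ExteriorAlgebra S[X] (ℕ →₀ S[X])} (hx : x ∈ lowDegree S d n) (m : ℕ) (hm : d ≤ m) :
    (homPf (polyHom f) n x).coeff m = 0 := by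
  induction hx using AddSubgroup.closure_induction with
  | mem x hx =>
    obtain ⟨i, L, hi, rfl, rfl⟩ := hx
    obtain ⟨b, hb⟩ := homPf_polyHom_stdWedge f L
    rw [map_smul, hb, smul_eq_mul, mul_comm, Polynomial.coeff_C_mul_X_pow, if_neg (by omega)]
  | zero => simp
  | add x y _ _ hx hy => rw [map_add, Polynomial.coeff_add, hx, hy, add_zero]
  | neg x _ hx => rw [map_neg, Polynomial.coeff_neg, hx, neg_zero]

/-- The strict partition without its first part. -/
def StrictPartition.tail (nu : StrictPartition) : StrictPartition where
  parts := nu.parts.tail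
  decreasing := nu.decreasing.tail
  pos := fun a ha => nu.pos a (List.mem_of_mem_tail ha)

theorem StrictPartition.tail_parts (nu : StrictPartition) : nu.tail.parts = nu.parts.tail := rfl

/-- By `wedge_stepVecs_sub_mem` the leading term is u^k times the value for the tail with a 0
appended, and `homPf_append_zero` removes the 0. -/
theorem coeff_adjoinHom_Pbasis (f : Gam →+* S) (nu : StrictPartition) (k : ℕ) (L : List ℕ)
    (h : nu.parts = k :: L) (m : ℕ) (hm : k ≤ m) :
    (adjoinHom f (Pbasis nu)).coeff m = if k = m then f (Pbasis nu.tail) else 0 := by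
  have hdec := nu.decreasing
  have hpos := nu.pos
  rw [h] at hdec hpos
  have hlow := wedge_stepVecs_sub_mem (S := S) k L hdec
  have htail : homPf (polyHom f) (L.length + 1) (stdWedge S[X] (L ++ [0])) =
      Polynomial.C (f (Pbasis nu.tail)) := by
    have h1 := homPf_append_zero (polyHom f) L fun x hx => hpos x (by simp [hx])
    rw [List.length_append, List.length_singleton] at h1
    have h2 : nu.tail.parts = L := by rw [StrictPartition.tail_parts, h, List.tail_cons]
    rw [h1, ← RingHom.comp_apply, map_Pbasis, h2]
  rw [adjoinHom_Pbasis, h, wedge_stepVecs _ k L hdec fun x hx => hpos x (by simp [hx]),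
    List.length_cons, ← sub_add_cancel (wedge (stepVecs (Polynomial.X : S[X]) k L))
      ((Polynomial.X : S[X]) ^ k • stdWedge S[X] (L ++ [0])), map_add, Polynomial.coeff_add,
    coeff_homPf_of_mem_lowDegree f hlow m hm, zero_add, map_smul, htail, smul_eq_mul, mul_comm,
    Polynomial.coeff_C_mul_X_pow]
  simp only [eq_comm]

/-- The coefficient of `u^m` in the image under `adjoinHom`. -/
def adjoinCoeff (f : Gam →+* S) (m : ℕ) : Gam →ₗ[ℤ] S :=
  ((Polynomial.lcoeff S m).toAddMonoidHom.comp (adjoinHom f).toAddMonoidHom).toIntLinearMap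

theorem adjoinCoeff_apply (f : Gam →+* S) (m : ℕ) (x : Gam) :
    adjoinCoeff f m x = (adjoinHom f x).coeff m := rfl

/-- The homomorphism `Γ' → ℤ` that annihilates the `P_k`. -/
def augmentation : Gam →+* ℤ :=
  liftGam (fun k => if k = 0 then 1 else 0) rfl fun k => by simp [skewEntry]

theorem Pbasis_of_parts_eq_nil (nu : StrictPartition) (h : nu.parts = []) : Pbasis nu = 1 := by
  obtain rfl : nu = ⟨[], by simp, by simp⟩ := StrictPartition.ext h
  rfl

/-- The coefficient of u^{N+1} strips the first part from those ν with ν_1 = N + 1 and kills all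
others. Stripping is injective on these ν, so the induction hypothesis makes their coefficients
vanish, and it then applies to the rest. -/
theorem eq_zero_of_linearCombination_Pbasis (N : ℕ) :
    ∀ a : StrictPartition →₀ ℤ, (∀ nu ∈ a.support, ∀ x ∈ nu.parts, x ≤ N) →
      Finsupp.linearCombination ℤ Pbasis a = 0 → a = 0 := by
  induction N with
  | zero =>
    intro a ha h0
    have hnil : ∀ nu ∈ a.support, nu.parts = [] := fun nu hnu =>
      List.eq_nil_iff_forall_not_mem.mpr fun x hx => by
        have := ha nu hnu x hx
        have := nu.pos x hx
        omega
    ext nu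
    by_contra hne
    have hnu : nu ∈ a.support := Finsupp.mem_support_iff.mpr hne
    have hsupp : a.support = {nu} := Finset.eq_singleton_iff_unique_mem.mpr
      ⟨hnu, fun mu hmu => StrictPartition.ext ((hnil mu hmu).trans (hnil nu hnu).symm)⟩
    rw [Finsupp.linearCombination_apply, Finsupp.sum, hsupp, Finset.sum_singleton,
      Pbasis_of_parts_eq_nil nu (hnil nu hnu)] at h0
    -- Only the empty partition is left, and the map to ℤ shows that 1 has infinite additive order
    -- in Γ'.
    have := congrArg augmentation h0
    rw [map_zsmul, map_one, map_zero] at this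
    exact hne (by simpa using this)
  | succ N ih =>
    intro a ha h0
    classical
    let T := adjoinCoeff (RingHom.id Gam) (N + 1)
    let s : Set StrictPartition := {nu | nu.parts.head? = some (N + 1)}
    have hT : ∀ nu ∈ a.support, T (Pbasis nu) = if nu ∈ s then Pbasis nu.tail else 0 := by
      intro nu hnu
      rw [adjoinCoeff_apply]
      rcases eq_or_ne nu.parts [] with h | h
      · have hs : nu ∉ s := by simp [s, h]
        rw [if_neg hs, Pbasis_of_parts_eq_nil nu h, map_one, Polynomial.coeff_one, if_neg (by omega)]
      · obtain ⟨k, L, h⟩ := List.exists_cons_of_ne_nil h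
        have hk : k ≤ N + 1 := ha nu hnu k (by simp [h])
        rw [coeff_adjoinHom_Pbasis _ nu k L h _ hk]
        simp [s, h]
    have hb : (a.filter (· ∈ s)).mapDomain StrictPartition.tail = 0 := by
      refine ih _ ?_ ?_
      · intro nu hnu x hx
        obtain ⟨mu, hmu, rfl⟩ := Finset.mem_image.mp (Finsupp.mapDomain_support hnu)
        rw [Finsupp.support_filter, Finset.mem_filter] at hmu
        obtain ⟨hmu, hs⟩ := hmu
        obtain ⟨L, hL⟩ := List.head?_eq_some_iff.mp hs
        have hdec := mu.decreasing
        rw [hL, List.pairwise_cons] at hdec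
        rw [StrictPartition.tail_parts, hL, List.tail_cons] at hx
        exact Nat.lt_succ_iff.mp (hdec.1 x hx)
      · rw [Finsupp.linearCombination_mapDomain, ← map_zero T, ← h0,
          Finsupp.linearCombination_apply, Finsupp.linearCombination_apply, Finsupp.sum_filter_index,
          Finsupp.sum, map_sum, Finsupp.support_filter, Finset.sum_filter]
        refine Finset.sum_congr rfl fun nu hnu => ?_
        rw [map_smul, hT nu hnu]
        split_ifs <;> simp
    have hs : ∀ nu ∈ s, a nu = 0 := by
      intro nu hnu
      have hinj : Set.InjOn StrictPartition.tail s := by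
        intro mu hmu mu' hmu' h
        obtain ⟨L, hL⟩ := List.head?_eq_some_iff.mp hmu
        obtain ⟨L', hL'⟩ := List.head?_eq_some_iff.mp hmu'
        have h := congrArg StrictPartition.parts h
        rw [StrictPartition.tail_parts, StrictPartition.tail_parts, hL, hL', List.tail_cons,
          List.tail_cons] at h
        exact StrictPartition.ext (by rw [hL, hL', h])
      have := Finsupp.mapDomain_apply' s (a.filter (· ∈ s)) (by intro mu hmu; simp_all) hinj hnu
      rw [hb, Finsupp.filter_apply_pos _ _ hnu] at this
      simpa using this.symm
    refine ih a (fun nu hnu x hx => ?_) h0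
    have hle := ha nu hnu
    have hdec := nu.decreasing
    have hns : nu ∉ s := fun h => Finsupp.mem_support_iff.mp hnu (hs nu h)
    rcases eq_or_ne nu.parts [] with h | h
    · simp [h] at hx
    · obtain ⟨k, L, h⟩ := List.exists_cons_of_ne_nil h
      rw [h] at hx hle hdec
      rw [List.pairwise_cons] at hdec
      have hk : k ≤ N + 1 := hle k (by simp)
      have hk' : k ≠ N + 1 := fun hk => hns (by simp [s, h, hk])
      rcases List.mem_cons.mp hx with rfl | hx
      · omega
      · have := hdec.1 x hx
        omega

theorem linearIndependent_Pbasis : LinearIndependent ℤ Pbasis := by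
  rw [linearIndependent_iff]
  intro a h
  refine eq_zero_of_linearCombination_Pbasis (a.support.sup fun nu => nu.parts.sum) a
    (fun nu hnu x hx => ?_) h
  exact (List.le_sum_of_mem hx).trans (Finset.le_sup (f := fun nu => nu.parts.sum) hnu)

theorem IsExpansion.unique {σ : Type} {f : MvPolynomial σ Gam}
    {a b : StrictPartition →₀ MvPolynomial σ ℤ} (ha : IsExpansion f a) (hb : IsExpansion f b) :
    a = b := by
  -- Comparing the coefficients of each monomial in the variables reduces the claim to integral
  -- relations among the P_ν.
  have key : ∀ (c : StrictPartition →₀ MvPolynomial σ ℤ) (m : σ →₀ ℕ), IsExpansion f c →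
      MvPolynomial.coeff m f = Finsupp.linearCombination ℤ Pbasis
        (c.mapRange (MvPolynomial.coeff m) (MvPolynomial.coeff_zero m)) := by
    intro c m hc
    rw [hc, Finsupp.linearCombination_apply, Finsupp.sum_mapRange_index (by simp), Finsupp.sum,
      Finsupp.sum, MvPolynomial.coeff_sum]
    refine Finset.sum_congr rfl fun nu _ => ?_
    rw [mul_comm, MvPolynomial.coeff_C_mul, MvPolynomial.coeff_map, zsmul_eq_mul,
      mul_comm]
    rfl
  ext nu m
  have h := linearIndependent_Pbasis ((key a m ha).symm.trans (key b m hb))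
  simpa using DFunLike.congr_fun h nu

end Independence

/-! ### The Chern series of the statement -/

section Chern

variable {R S : Type*} [CommRing R] [CommRing S]

theorem coeff_mul_eq_zero {c c' : R⟦X⟧} {a b : ℕ} (hc : ∀ m, a < m → PowerSeries.coeff m c = 0)
    (hc' : ∀ m, b < m → PowerSeries.coeff m c' = 0) (m : ℕ) (hm : a + b < m) :
    PowerSeries.coeff m (c * c') = 0 := by
  rw [PowerSeries.coeff_mul]
  refine Finset.sum_eq_zero fun x hx => ?_
  rw [Finset.HasAntidiagonal.mem_antidiagonal] at hx
  rcases lt_or_ge a x.1 with h | h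
  · rw [hc _ h, zero_mul]
  · rw [hc' _ (by omega), mul_zero]

theorem coeff_chern_eq_zero (z : ℕ → R) (n m : ℕ) (hm : n < m) :
    PowerSeries.coeff m (chern z n) = 0 := by
  induction n generalizing m with
  | zero => simp [chern, PowerSeries.coeff_one, hm.ne']
  | succ n ih =>
    rw [chern, Finset.prod_range_succ]
    refine coeff_mul_eq_zero (a := n) (b := 1) ih (fun m hm => ?_) m hm
    obtain ⟨m, rfl⟩ := Nat.exists_eq_add_of_le' hm
    simp [PowerSeries.coeff_one]

theorem map_chern (f : R →+* S) (z : ℕ → R) (n : ℕ) :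
    PowerSeries.map f (chern z n) = chern (fun j => f (z j)) n := by
  simp [chern]

theorem map_chern_X {σ : Type} (v : ℕ → σ) (n : ℕ) :
    PowerSeries.map (MvPolynomial.map (Int.castRingHom Gam))
      (chern (fun j => (MvPolynomial.X (v j) : MvPolynomial σ ℤ)) n) =
      chern (fun j => (MvPolynomial.X (v j) : MvPolynomial σ Gam)) n := by
  refine (map_chern (S := MvPolynomial σ Gam) _ _ n).trans ?_
  congr 1
  funext j
  exact MvPolynomial.map_X _ _

end Chern

/-! ### The expansions for partitions and triples -/

/-- The lengths of λ and λ(+) agree only through a proof, so the index types have to be identified.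
-/
theorem PfB_cast {R : Type*} [CommRing R] [Algebra Gam R] {r r' : ℕ} (h : r = r')
    (lam : Fin r' → ℕ) (c : Fin r' → R⟦X⟧) :
    PfB (fun i => lam (Fin.cast h i)) (fun i => c (Fin.cast h i)) = PfB lam c := by
  subst h
  rfl

theorem exists_unique_expansions {σ : Type} {n : ℕ} (lam : Fin n → ℕ)
    (c : Fin n → (MvPolynomial σ ℤ)⟦X⟧) (hc : ∀ i m, lam i < m → PowerSeries.coeff m (c i) = 0)
    (f g : MvPolynomial σ Gam)
    (hf : f = PfB (fun i => lam i + 1)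
      fun i => PowerSeries.map (MvPolynomial.map (Int.castRingHom Gam)) (c i))
    (hg : g = PfD lam fun i => PowerSeries.map (MvPolynomial.map (Int.castRingHom Gam)) (c i)) :
    ∃ p r : StrictPartition →₀ MvPolynomial σ ℤ,
      (∀ a, IsExpansion f a ↔ a = p) ∧ (∀ a, IsExpansion g a ↔ a = r) ∧
      ∀ mu : PartitionD, mu.length ≡ n [MOD 2] → r mu.strict = p mu.plus := by
  obtain ⟨p, r, hp, hr, h⟩ := exists_expansions lam c hc
  rw [← hf] at hp
  rw [← hg] at hr
  exact ⟨p, r, fun a => ⟨fun ha => ha.unique hp, fun ha => ha ▸ hp⟩,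
    fun a => ⟨fun ha => ha.unique hr, fun ha => ha ▸ hr⟩, h⟩

theorem exists_unique_expansions_partition (lam : PartitionD) :
    ∃ p r : StrictPartition →₀ MvPolynomial ℕ ℤ,
      (∀ a, IsExpansion (PPoly lam.plus) a ↔ a = p) ∧ (∀ a, IsExpansion (RPoly lam) a ↔ a = r) ∧
      ∀ mu : PartitionD, mu.length ≡ lam.length [MOD 2] → r mu.strict = p mu.plus := by
  refine exists_unique_expansions (n := lam.length) lam.parts.get
    (fun i => chern MvPolynomial.X (lam.parts.get i)) (fun i m h => coeff_chern_eq_zero _ _ m h)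
    _ _ ?_ ?_
  · have h : lam.parts.length = lam.plus.parts.length := (List.length_map ..).symm
    have hget : ∀ i, lam.plus.parts.get (Fin.cast h i) = lam.parts.get i + 1 := fun i => by
      simp only [PartitionD.plus, List.get_eq_getElem, List.getElem_map]
      rfl
    rw [PPoly, ← PfB_cast h]
    simp only [hget, Nat.add_sub_cancel]
    exact congrArg _ (funext fun i => (map_chern_X id _).symm)
  · exact congrArg (fun c : Fin lam.parts.length → GamT⟦X⟧ => PfD lam.parts.get c)
      (funext fun i => (map_chern_X id _).symm)

theorem exists_unique_expansions_triple (t : TripleD) :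
    ∃ p r : StrictPartition →₀ MvPolynomial (ℕ ⊕ ℕ) ℤ,
      (∀ a, IsExpansion t.plus.PPoly a ↔ a = p) ∧ (∀ a, IsExpansion t.RPoly a ↔ a = r) ∧
      ∀ mu : PartitionD, mu.length ≡ t.r [MOD 2] → r mu.strict = p mu.plus := by
  have hmap : ∀ a b, PowerSeries.map (MvPolynomial.map (Int.castRingHom Gam))
      (chern (fun j => MvPolynomial.X (Sum.inl j)) a * chern (fun j => MvPolynomial.X (Sum.inr j)) b)
      = chernXY a b := fun a b => by
    rw [chernXY, ← map_chern_X Sum.inl, ← map_chern_X Sum.inr]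
    exact map_mul ..
  refine exists_unique_expansions t.lam
    (fun m => chern (fun j => MvPolynomial.X (Sum.inl j)) (t.p (t.block m)) *
      chern (fun j => MvPolynomial.X (Sum.inr j)) (t.q (t.block m)))
    (fun i m h => coeff_mul_eq_zero (coeff_chern_eq_zero _ _) (coeff_chern_eq_zero _ _) m ?_)
    _ _ ?_ ?_
  · exact lt_of_le_of_lt (Nat.le_add_right ..) h
  · simp only [hmap]
    -- The -1 in type C absorbs one of the two units added to p_i and q_i, so λ_m grows by exactly
    -- 1, while the series keeps its p_i + q_i factors.
    have hlam : ∀ m : Fin t.r, TripleC.lam t.plus m = t.lam m + 1 := fun m => by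
      change t.p (t.block m) + 1 + (t.q (t.block m) + 1) - 1 + (t.k (t.block m) - ((m : ℕ) + 1)) =
        t.p (t.block m) + t.q (t.block m) + (t.k (t.block m) - ((m : ℕ) + 1)) + 1
      omega
    exact congrArg (fun l : Fin t.r → ℕ => PfB l fun m =>
      chernXY (t.p (t.block m)) (t.q (t.block m))) (funext hlam)
  · simp only [hmap]
    rfl

/-! ### Agreement of the signed permutations -/

theorem TripleD.barring_plus (t : TripleD) (n : ℕ) : t.plus.barring n = t.barring n := by
  induction n with
  | zero => rfl
  | succ n ih =>
    rw [TripleC.barring, TripleD.barring, ih]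
    rfl

theorem TripleD.w_plus (t : TripleD) : t.plus.w = t.w :=
  congrArg Barring.toSignedPerm (t.barring_plus t.s)

end TypeBD

end

theorem mainTheorem10 :
    (∀ lam : TypeBD.PartitionD,
      ∃ p r : TypeBD.StrictPartition →₀ MvPolynomial ℕ ℤ,
        (∀ a, TypeBD.IsExpansion (TypeBD.PPoly lam.plus) a ↔ a = p) ∧
        (∀ a, TypeBD.IsExpansion (TypeBD.RPoly lam) a ↔ a = r) ∧
        ∀ mu : TypeBD.PartitionD, mu.length ≡ lam.length [MOD 2] →
          r mu.strict = p mu.plus) ∧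
    (∀ tau : TypeBD.TripleD,
      (∃ p r : TypeBD.StrictPartition →₀ MvPolynomial (ℕ ⊕ ℕ) ℤ,
        (∀ a, TypeBD.IsExpansion tau.plus.PPoly a ↔ a = p) ∧
        (∀ a, TypeBD.IsExpansion tau.RPoly a ↔ a = r) ∧
        ∀ mu : TypeBD.PartitionD, mu.length ≡ tau.r [MOD 2] →
          r mu.strict = p mu.plus) ∧
      tau.plus.w = tau.w) :=
  ⟨TypeBD.exists_unique_expansions_partition, fun tau =>
    ⟨TypeBD.exists_unique_expansions_triple tau, tau.w_plus⟩⟩
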